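/- **Setting.** Let $k,l\ge 0$ and let $S$ be a $k$-solenoid: a compact Hausdorff space with an atlas of flow-boxes, i.e. homeomorphisms $\varphi:U\to D^k\times K(U)$ from open sets $U\subset S$, where $D^k$ is the open unit ball of $\mathbb R^k$ and $K(U)\subset\mathbb R^l$, whose changes of charts are locally of the form $(x,y)\mapsto (X(x,y),Y(y))$ with $X,Y$ continuous, and $X$ differentiable in $x$ with $\partial X/\partial x$ jointly continuous (class $C^{1,0}$; solenoids of class $C^{r,s}$ with $r\ge1$ are a special case). "Flow-box" means any flow-box compatible with the atlas. Write $L_y=\varphi^{-1}(D^k\times\{y\})$ for its local leaves and $T=\varphi^{-1}(\{0\}\times K(U))$ for its local transversal. The leaf topology on $S$ is generated by the open subsets of local leaves; a leaf is a nonempty subset, connected in the leaf topology, whose intersection with every flow-box is a union of local leaves. $S$ is Riemannian: every leaf has a Riemannian metric whose coefficients in each flow-box are continuous in $(x,y)$; $\mathrm{Vol}_k$ is the Riemannian volume on leaves. A *transversal measure* $(\mu_T)$ assigns to each local transversal $T$ a locally finite Borel measure on $T$, invariant under holonomy maps along paths in leaves. $S$ is *uniquely ergodic* if it has a nonzero transversal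 measure, unique up to a positive scalar, and the support of this measure is the whole of $S$. A Borel measure $\mu$ on $S$ is *daval* (disintegrates as volume along leaves) if for every flow-box $(U,\varphi)$ with local transversal $T$ there is a measure $\mu_{U,T}$ supported on $T$ such that, for all Borel $A\subset U$, $$\mu(A)=\int_T \mathrm{Vol}_k(A_t)\,d\mu_{U,T}(t),$$ where $A_t$ is the intersection of $A$ with the local leaf through $t$. A *volume* of $S$ is a probability measure $\mu$ for which this holds in every flow-box with $\mu_{U,T}=\mu_T$ for one transversal measure $(\mu_T)$. An *exhaustion* $(C_n)$ of a leaf $\ell$ is an increasing sequence of Borel subsets of $\ell$, relatively compact in $\ell$, with union $\ell$. For a flow-box $U$ write $C_n\cap U=A_n\cup B_n$, where $A_n$ is the union of the full disks $L_y$ contained in $C_n$ and $B_n$ is the union of the other connected components of $C_n\cap U$. *$S$ has controlled growth with respect to $\ell$ and $(C_n)$* if $S$ has a finite covering by flow-boxes $U$ for each of which $\mathrm{Vol}_k(B_n)/\mathrm{Vol}_k(A_n)\to0$ (with $0/0=0$ and $c/0=\infty$ for $c>0$). $S$ has *controlled growth* if this holds for some leaf $\ell$ and some exhaustion $(C_n)$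 of $\ell$. A *Schwartzman measure* is a probability measure $\mu$ on $S$ which is the weak limit of the measures $\mu_n=\mathrm{Vol}_k|_{C_n}/\mathrm{Vol}_k(C_n)$ (defined for large $n$), for some leaf $\ell$ and some exhaustion $(C_n)$ of $\ell$ with respect to which $S$ has controlled growth. **Theorem.** Let $S$ be a Riemannian solenoid with controlled growth. 1. Every Schwartzman measure on $S$ is a daval probability measure. 2. Daval probability measures exist on $S$, and $S$ admits a nonzero transversal measure. 3. If moreover $S$ is uniquely ergodic, then $S$ has exactly one volume $\mu$, and $\mu$ is the unique Schwartzman measure on $S$ (in particular one exists). For every leaf $\ell$ and every exhaustion $(C_n)$ of $\ell$ with respect to which $S$ has controlled growth, the whole sequence of normalized volumes $\mu_n$ converges weakly to $\mu$; so the limit is independent of the leaf and of the exhaustion. -/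

import Mathlib

open MeasureTheory Filter Topology

noncomputable section

/-- A flow-box of dimension `k` with transversal set in `ℝ^l`: a homeomorphism `φ` from an open
subset `U` (`source`) of `S` onto `D^k × K(U)` (`target`), where `D^k` is the open unit ball of
`ℝ^k` and `K(U)` (`transv`) is a subset of `ℝ^l`. -/
structure FlowBox (k l : ℕ) (S : Type*) [TopologicalSpace S] extends
    PartialEquiv S (EuclideanSpace ℝ (Fin k) × EuclideanSpace ℝ (Fin l)) where
  transv : Set (EuclideanSpace ℝ (Fin l))
  open_source : IsOpen source
  target_eq : target = Metric.ball 0 1 ×ˢ transv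
  continuousOn_toFun : ContinuousOn toFun source
  continuousOn_invFun : ContinuousOn invFun target

namespace FlowBox

variable {k l : ℕ} {S : Type*} [TopologicalSpace S]

/-- The local leaf `L_y = φ⁻¹ (D^k × {y})`. -/
def plaque (φ : FlowBox k l S) (y : EuclideanSpace ℝ (Fin l)) : Set S :=
  φ.invFun '' (Metric.ball 0 1 ×ˢ {y})

/-- The local transversal `T = φ⁻¹ ({0} × K(U))` of the flow-box. -/
def transversal (φ : FlowBox k l S) : Set S :=
  φ.invFun '' ({0} ×ˢ φ.transv)

/-- The differential at `p`, along the leaf, of the change of charts from `φ` to `ψ`: if the change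
of charts is `(x, y) ↦ (X(x, y), Y(y))`, this is the partial differential `∂X/∂x` at `φ p`. -/
def leafDeriv (φ ψ : FlowBox k l S) (p : S) :
    EuclideanSpace ℝ (Fin k) →L[ℝ] EuclideanSpace ℝ (Fin k) :=
  fderiv ℝ (fun x => (ψ.toFun (φ.invFun (x, (φ.toFun p).2))).1) (φ.toFun p).1

/-- The change of charts from `φ` to `ψ` is, locally on the overlap, of the form
`(x, y) ↦ (X(x, y), Y(y))`, and `X` is differentiable in `x` with a differential that is jointly
continuous in `(x, y)`. (Continuity of `X` and of `Y` is automatic, as `φ` and `ψ` are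
homeomorphisms.) -/
structure Compatible (φ ψ : FlowBox k l S) : Prop where
  transverse : ∀ p ∈ φ.source ∩ ψ.source,
    ∃ Y : EuclideanSpace ℝ (Fin l) → EuclideanSpace ℝ (Fin l),
      ∀ᶠ q in 𝓝 p, (ψ.toFun q).2 = Y (φ.toFun q).2
  differentiable : ∀ p ∈ φ.source ∩ ψ.source,
    DifferentiableAt ℝ (fun x => (ψ.toFun (φ.invFun (x, (φ.toFun p).2))).1) (φ.toFun p).1
  continuousOn_leafDeriv : ContinuousOn (leafDeriv φ ψ) (φ.source ∩ ψ.source)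

end FlowBox

/-- An atlas of flow-boxes on `S`. When `S` is compact and Hausdorff this is a `k`-solenoid.
The changes of charts are asked to be of class `C^{1,0}`, the least regularity for which the leaves
can carry a Riemannian metric; solenoids of class `C^{r,s}` with `r ≥ 1` are special cases. -/
structure Solenoid (k l : ℕ) (S : Type*) [TopologicalSpace S] where
  atlas : Set (FlowBox k l S)
  cover : ∀ p : S, ∃ φ ∈ atlas, p ∈ φ.source
  compatible : ∀ φ ∈ atlas, ∀ ψ ∈ atlas, φ.Compatible ψ

namespace Solenoid

variable {k l : ℕ} {S : Type*} [TopologicalSpace S]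

/-- The flow-boxes of the solenoid: those compatible with all flow-boxes of the atlas. -/
def IsFlowBox (𝓢 : Solenoid k l S) (φ : FlowBox k l S) : Prop :=
  ∀ ψ ∈ 𝓢.atlas, φ.Compatible ψ ∧ ψ.Compatible φ

/-- The leaf topology on `S`, generated by the open subsets of the local leaves. -/
@[reducible] def leafTopology (𝓢 : Solenoid k l S) : TopologicalSpace S :=
  TopologicalSpace.generateFrom
    {s | ∃ φ : FlowBox k l S, 𝓢.IsFlowBox φ ∧ ∃ y ∈ φ.transv,
      ∃ W : Set (EuclideanSpace ℝ (Fin k)), IsOpen W ∧ W ⊆ Metric.ball 0 1 ∧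
        s = φ.invFun '' (W ×ˢ {y})}

/-- A leaf: a (nonempty) subset, connected for the leaf topology, whose intersection with any
flow-box is a union of local leaves. -/
structure IsLeaf (𝓢 : Solenoid k l S) (L : Set S) : Prop where
  connected : @IsConnected S 𝓢.leafTopology L
  saturated : ∀ φ, 𝓢.IsFlowBox φ → ∀ p ∈ L ∩ φ.source, φ.plaque (φ.toFun p).2 ⊆ L

/-- The local transversals of the solenoid: the transversals of its flow-boxes. -/
def LocalTransversal (𝓢 : Solenoid k l S) : Type _ :=
  {T : Set S // ∃ φ : FlowBox k l S, 𝓢.IsFlowBox φ ∧ T = φ.transversal}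

/-- The local transversal of a flow-box of the solenoid. -/
def transversalOf (𝓢 : Solenoid k l S) (φ : FlowBox k l S) (hφ : 𝓢.IsFlowBox φ) :
    𝓢.LocalTransversal :=
  ⟨φ.transversal, φ, hφ, rfl⟩

/-- `h` is a holonomy map from `T₁` to `T₂`: a homeomorphism from an open subset of `T₁` onto an
open subset of `T₂`, which moves each point `t` to `h t` along a path `H (t, ·)` contained in a leaf,
where the path depends continuously on `t`. -/
structure IsHolonomy (𝓢 : Solenoid k l S) (T₁ T₂ : 𝓢.LocalTransversal)
    (h : PartialEquiv S S) : Prop where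
  source_open : ∃ O : Set S, IsOpen O ∧ h.source = O ∩ T₁.1
  target_open : ∃ O : Set S, IsOpen O ∧ h.target = O ∩ T₂.1
  continuousOn : ContinuousOn h h.source
  continuousOn_symm : ContinuousOn h.symm h.target
  exists_paths : ∃ H : S × unitInterval → S, ContinuousOn H (h.source ×ˢ Set.univ) ∧
    ∀ t ∈ h.source, H (t, 0) = t ∧ H (t, 1) = h t ∧
      @Continuous unitInterval S inferInstance 𝓢.leafTopology (fun s => H (t, s))

/-- A transversal measure `(μ_T)`: for every local transversal `T`, a locally finite Borel measure
`μ_T` on `T` (seen as a measure on `S` for which the complement of `T` is null), such that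
`h_* μ_{T₁} = μ_{T₂}` for every holonomy map `h` (between the domain and the image of `h`). -/
structure IsTransversalMeasure [MeasurableSpace S] (𝓢 : Solenoid k l S)
    (m : 𝓢.LocalTransversal → Measure S) : Prop where
  supported : ∀ T, m T (T.1)ᶜ = 0
  locallyFinite : ∀ T, ∀ t ∈ T.1, ∃ V ∈ 𝓝 t, m T V < ⊤
  invariant : ∀ T₁ T₂ h, 𝓢.IsHolonomy T₁ T₂ h →
    Measure.map h ((m T₁).restrict h.source) = (m T₂).restrict h.target

/-- The support of the transversal measure is the whole of `S`: every nonempty open subset of every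
local transversal has positive measure. -/
def HasFullSupport [MeasurableSpace S] (𝓢 : Solenoid k l S)
    (m : 𝓢.LocalTransversal → Measure S) : Prop :=
  ∀ T, ∀ t ∈ T.1, ∀ V ∈ 𝓝 t, 0 < m T V

/-- Unique ergodicity: up to positive scalars there is exactly one nonzero transversal measure, and
its support is the whole of `S`. -/
def UniquelyErgodic [MeasurableSpace S] (𝓢 : Solenoid k l S) : Prop :=
  ∃ m, 𝓢.IsTransversalMeasure m ∧ m ≠ 0 ∧ 𝓢.HasFullSupport m ∧
    ∀ m', 𝓢.IsTransversalMeasure m' → m' ≠ 0 → ∃ c : NNReal, 0 < c ∧ ∀ T, m' T = c • m T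

/-- An exhaustion of the leaf `L`: an increasing sequence of Borel subsets of `L`, relatively compact
in `L`, with union `L`. -/
structure IsExhaustion [MeasurableSpace S] (𝓢 : Solenoid k l S) (L : Set S) (C : ℕ → Set S) :
    Prop where
  measurableSet : ∀ n, MeasurableSet (C n)
  relCompact : ∀ n, ∃ Q : Set S, @IsCompact S 𝓢.leafTopology Q ∧ C n ⊆ Q ∧ Q ⊆ L
  monotone : Monotone C
  iUnion_eq : ⋃ n, C n = L

/-- A Riemannian metric on the leaves, continuous on `S`. In every flow-box `φ` it is given by inner
products `g φ (x, y)` on the tangent space `ℝ^k` of the local leaf `L_y`, which depend continuously on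
`(x, y)` and transform as a covariant 2-tensor along the leaves under changes of flow-boxes. (Values
of `g` at points outside the flow-box, or for a `φ` that is not a flow-box of the solenoid, play no
role.) -/
structure RiemannianMetric (𝓢 : Solenoid k l S) where
  g : FlowBox k l S → EuclideanSpace ℝ (Fin k) × EuclideanSpace ℝ (Fin l) →
    EuclideanSpace ℝ (Fin k) →L[ℝ] EuclideanSpace ℝ (Fin k) →L[ℝ] ℝ
  symm : ∀ φ, 𝓢.IsFlowBox φ → ∀ z ∈ φ.target, ∀ u v, g φ z u v = g φ z v u
  pos : ∀ φ, 𝓢.IsFlowBox φ → ∀ z ∈ φ.target, ∀ v, v ≠ 0 → 0 < g φ z v v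
  continuousOn : ∀ φ, 𝓢.IsFlowBox φ → ContinuousOn (g φ) φ.target
  transform : ∀ φ ψ, 𝓢.IsFlowBox φ → 𝓢.IsFlowBox ψ → ∀ p ∈ φ.source ∩ ψ.source, ∀ u v,
    g φ (φ.toFun p) u v =
      g ψ (ψ.toFun p) (FlowBox.leafDeriv φ ψ p u) (FlowBox.leafDeriv φ ψ p v)

namespace RiemannianMetric

variable {𝓢 : Solenoid k l S}

/-- The Riemannian volume density `√(det g_{ij})` in a flow-box. -/
def density (G : 𝓢.RiemannianMetric) (φ : FlowBox k l S)
    (z : EuclideanSpace ℝ (Fin k) × EuclideanSpace ℝ (Fin l)) : ℝ :=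
  √(Matrix.det (Matrix.of fun i j : Fin k =>
    G.g φ z (EuclideanSpace.single i 1) (EuclideanSpace.single j 1)))

variable [MeasurableSpace S]

/-- The Riemannian `k`-volume of the local leaf `L_y`, as a measure on `S`:
`A ↦ Vol_k (A ∩ L_y)`. -/
def plaqueVol (G : 𝓢.RiemannianMetric) (φ : FlowBox k l S) (y : EuclideanSpace ℝ (Fin l)) :
    Measure S :=
  Measure.map (fun x => φ.invFun (x, y))
    ((volume.restrict (Metric.ball 0 1)).withDensity
      fun x => ENNReal.ofReal (G.density φ (x, y)))

/-- The Riemannian `k`-volume of the leaf `L`, as a measure on `S`: the smallest measure that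
dominates the volumes of all local leaves contained in `L`. (The volumes of two local leaves agree on
their intersection, so this measure restricts to the volume of each of them.) -/
def leafVol (G : 𝓢.RiemannianMetric) (L : Set S) : Measure S :=
  ⨆ (φ : FlowBox k l S) (_ : 𝓢.IsFlowBox φ) (y : EuclideanSpace ℝ (Fin l)) (_ : y ∈ φ.transv)
    (_ : φ.plaque y ⊆ L), G.plaqueVol φ y

/-- The measure `μ` is the product of the volume along the leaves and of the measure `ν` on the
transversal `T` of the flow-box: `μ(A) = ∫_T Vol_k (A_y) dν(y)` for every Borel set `A ⊆ U`. -/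
def DisintegratesBy (G : 𝓢.RiemannianMetric) (φ : FlowBox k l S) (μ ν : Measure S) : Prop :=
  ∀ A : Set S, MeasurableSet A → A ⊆ φ.source →
    μ A = ∫⁻ t, G.plaqueVol φ (φ.toFun t).2 A ∂ν

/-- Daval measures: measures which disintegrate as volume along leaves, in every flow-box, for some
measure supported on the transversal of the flow-box. -/
def IsDaval (G : 𝓢.RiemannianMetric) (μ : Measure S) : Prop :=
  ∀ φ, 𝓢.IsFlowBox φ → ∃ ν : Measure S, ν φ.transversalᶜ = 0 ∧ G.DisintegratesBy φ μ ν

/-- A volume of the solenoid: a probability measure that is the product of the volume along the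
leaves with some transversal measure `(μ_T)`. -/
def IsVolume (G : 𝓢.RiemannianMetric) (μ : Measure S) : Prop :=
  IsProbabilityMeasure μ ∧ ∃ m, 𝓢.IsTransversalMeasure m ∧
    ∀ φ (hφ : 𝓢.IsFlowBox φ), G.DisintegratesBy φ μ (m (𝓢.transversalOf φ hφ))

/-- The part `A` of `C ∩ U = A ∪ B`: the union of the full disks `L_y` contained in `C`. -/
def fullPart (φ : FlowBox k l S) (C : Set S) : Set S :=
  ⋃ y ∈ {y | y ∈ φ.transv ∧ φ.plaque y ⊆ C}, φ.plaque y

/-- The part `B` of `C ∩ U = A ∪ B`: the union of the connected components of `C ∩ U` (for the leaf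
topology) that are not full disks. A component of `C ∩ U` lies in one disk `L_y`, and it is a full
disk exactly when it is contained in `A`; so `B` is the complement of `A` in `C ∩ U`. -/
def partialPart (φ : FlowBox k l S) (C : Set S) : Set S :=
  (C ∩ φ.source) \ fullPart φ C

/-- Controlled growth with respect to the leaf `L` and the exhaustion `C`: there is a finite covering
of `S` by flow-boxes `U`, for each of which `Vol_k(B_n) / Vol_k(A_n) → 0`. The quotient is taken in
`[0, ∞]`, so it is `∞` when only `Vol_k(A_n)` vanishes, and it is `0` when both volumes vanish (as
they do for flow-boxes that the leaf does not meet). -/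
def ControlledGrowthAlong (G : 𝓢.RiemannianMetric) (L : Set S) (C : ℕ → Set S) : Prop :=
  ∃ F : Set (FlowBox k l S), F.Finite ∧ (∀ φ ∈ F, 𝓢.IsFlowBox φ) ∧
    (⋃ φ ∈ F, φ.source) = Set.univ ∧
    ∀ φ ∈ F, Tendsto
      (fun n => G.leafVol L (partialPart φ (C n)) / G.leafVol L (fullPart φ (C n))) atTop (𝓝 0)

/-- The solenoid has controlled growth with respect to some leaf and some exhaustion of it. -/
def HasControlledGrowth (G : 𝓢.RiemannianMetric) : Prop :=
  ∃ L C, 𝓢.IsLeaf L ∧ 𝓢.IsExhaustion L C ∧ G.ControlledGrowthAlong L C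

/-- The `k`-volume of the subset `C` of the leaf `L`, normalized to have total mass `1`. -/
def normalizedVol (G : 𝓢.RiemannianMetric) (L C : Set S) : Measure S :=
  (G.leafVol L C)⁻¹ • (G.leafVol L).restrict C

/-- The normalized volumes of the exhaustion `C` of the leaf `L` converge weakly to `μ`. -/
def IsSchwartzmanLimit (G : 𝓢.RiemannianMetric) (L : Set S) (C : ℕ → Set S) (μ : Measure S) : Prop :=
  ∀ f : C(S, ℝ), Tendsto (fun n => ∫ p, f p ∂(G.normalizedVol L (C n))) atTop (𝓝 (∫ p, f p ∂μ))

/-- Schwartzman measures: the probability measures that are limits of the normalized volumes of an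
exhaustion with controlled growth of a leaf. -/
def IsSchwartzmanMeasure (G : 𝓢.RiemannianMetric) (μ : Measure S) : Prop :=
  IsProbabilityMeasure μ ∧ ∃ L C, 𝓢.IsLeaf L ∧ 𝓢.IsExhaustion L C ∧
    G.ControlledGrowthAlong L C ∧ G.IsSchwartzmanLimit L C μ

end RiemannianMetric

end Solenoid

end

/-! Daval measures can be recognized by the functions that they kill. In a flow-box, divide a
measure by the Riemannian density (`flatten`). The measure disintegrates as volume along leaves
there exactly when the quotient is Lebesgue measure on the disk times a measure on `K(U)`
(`flatten_restrict_eq`, `disintegratesOn_of_flatten`). For a locally finite measure on the chart,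
being such a product near a point follows once all products `a(x) b(y)` with small support and `∫ a
= 0` have zero integral (`exists_const_of_integral_eq_zero`).

For such `a` and `b`, the function `f = a b / density` extends by zero to a continuous function on
`S` whose integral over every local leaf of `U` vanishes. Integrating `f` over `C_n`, the full disks
contribute nothing and only `B_n` remains. Hence `|∫ f dμ_n| ≤ ‖f‖ Vol(B_n) / Vol(C_n) ≤ ‖f‖
Vol(B_n) / Vol(A_n) → 0` (`abs_integral_normalizedVol_le`). So every limit `μ` of the `μ_n`, along
any filter finer than `atTop`, kills all these `f` and is locally a product in the flow-boxes of the
covering. Local products glue, because the disk is connected and `K(U)` is locally compact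
(`eq_prod_of_locally`). They pass to an arbitrary flow-box because volumes of local leaves agree on
overlaps (`plaqueVol_eq`, `exists_transfer`, `isProductIn_of_cover`). Thus `μ` is daval.

The transverse factor of a product is unique, so the factors in two flow-boxes correspond under
changes of charts. Continuation along paths in leaves turns this into holonomy invariance
(`transMeasure_holonomy`), and `μ` is a volume. Limits along ultrafilters exist by compactness of
the space of probability measures. If `S` is uniquely ergodic, two volumes are proportional, hence
equal; all ultrafilter limits then coincide, which is convergence of the whole sequence. -/

/-- The Euclidean space `ℝ^n`. -/
abbrev Eu (n : ℕ) := EuclideanSpace ℝ (Fin n)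

lemma ContinuousOn.measurableSet_inter_preimage' {X Y : Type*} [TopologicalSpace X]
    [MeasurableSpace X] [OpensMeasurableSpace X] [TopologicalSpace Y] [MeasurableSpace Y]
    [BorelSpace Y] {f : X → Y} {s : Set X} {t : Set Y}
    (hf : ContinuousOn f s) (hs : MeasurableSet s) (ht : MeasurableSet t) :
    MeasurableSet (s ∩ f ⁻¹' t) := by
  have h : Measurable (s.domRestrict f) := (continuousOn_iff_continuous_domRestrict.1 hf).measurable
  have := hs.subtype_image (h ht)
  convert this using 1
  ext x
  simp [Set.domRestrict, and_comm]

/-! ### Coordinates, local leaves and boxes in a flow-box. -/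

namespace FlowBox

variable {k l : ℕ} {S : Type*} [TopologicalSpace S] {φ ψ χ : FlowBox k l S}

lemma mem_target {z : Eu k × Eu l} :
    z ∈ φ.target ↔ z.1 ∈ Metric.ball (0 : Eu k) 1 ∧ z.2 ∈ φ.transv := by
  rw [φ.target_eq]; rfl

lemma toFun_mem {p : S} (hp : p ∈ φ.source) : φ.toFun p ∈ φ.target := φ.map_source' hp

lemma fst_mem {p : S} (hp : p ∈ φ.source) : (φ.toFun p).1 ∈ Metric.ball (0 : Eu k) 1 :=
  (mem_target.1 (toFun_mem hp)).1

lemma snd_mem {p : S} (hp : p ∈ φ.source) : (φ.toFun p).2 ∈ φ.transv :=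
  (mem_target.1 (toFun_mem hp)).2

lemma inv_mem {z : Eu k × Eu l} (hz : z ∈ φ.target) : φ.invFun z ∈ φ.source := φ.map_target' hz

lemma inv_toFun {p : S} (hp : p ∈ φ.source) : φ.invFun (φ.toFun p) = p := φ.left_inv' hp

lemma toFun_inv {z : Eu k × Eu l} (hz : z ∈ φ.target) : φ.toFun (φ.invFun z) = z :=
  φ.right_inv' hz

lemma mk_mem_target {x : Eu k} {y : Eu l} (hx : x ∈ Metric.ball (0 : Eu k) 1)
    (hy : y ∈ φ.transv) : (x, y) ∈ φ.target := mem_target.2 ⟨hx, hy⟩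

lemma zero_mk_mem_target {y : Eu l} (hy : y ∈ φ.transv) : ((0 : Eu k), y) ∈ φ.target :=
  mk_mem_target (by simp) hy

lemma mem_plaque {y : Eu l} (hy : y ∈ φ.transv) {q : S} :
    q ∈ φ.plaque y ↔ q ∈ φ.source ∧ (φ.toFun q).2 = y := by
  constructor
  · rintro ⟨⟨x, y'⟩, ⟨hx, rfl⟩, rfl⟩
    have h : (x, y') ∈ φ.target := mk_mem_target hx hy
    exact ⟨inv_mem h, by rw [toFun_inv h]⟩
  · rintro ⟨hq, rfl⟩
    exact ⟨φ.toFun q, ⟨fst_mem hq, rfl⟩, inv_toFun hq⟩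

lemma plaque_subset_source {y : Eu l} (hy : y ∈ φ.transv) : φ.plaque y ⊆ φ.source :=
  fun _ hq => ((mem_plaque hy).1 hq).1

lemma mem_transversal {q : S} : q ∈ φ.transversal ↔ q ∈ φ.source ∧ (φ.toFun q).1 = 0 := by
  constructor
  · rintro ⟨⟨x, y⟩, ⟨rfl, hy⟩, rfl⟩
    have h : ((0 : Eu k), y) ∈ φ.target := zero_mk_mem_target hy
    exact ⟨inv_mem h, by rw [toFun_inv h]⟩
  · rintro ⟨hq, h⟩
    exact ⟨φ.toFun q, ⟨h, snd_mem hq⟩, inv_toFun hq⟩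

lemma inv_zero_mem_transversal {y : Eu l} (hy : y ∈ φ.transv) :
    φ.invFun (0, y) ∈ φ.transversal := ⟨_, ⟨Set.mem_singleton _, hy⟩, rfl⟩

lemma inv_zero_snd {q : S} (hq : q ∈ φ.transversal) : φ.invFun (0, (φ.toFun q).2) = q := by
  obtain ⟨h, h0⟩ := mem_transversal.1 hq
  rw [← h0]; exact inv_toFun h

lemma disjoint_plaque {y z : Eu l} (hy : y ∈ φ.transv) (hz : z ∈ φ.transv) (h : y ≠ z) :
    Disjoint (φ.plaque y) (φ.plaque z) :=
  Set.disjoint_left.2 fun _ h₁ h₂ =>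
    h (((mem_plaque hy).1 h₁).2.symm.trans ((mem_plaque hz).1 h₂).2)

lemma continuousAt {p : S} (hp : p ∈ φ.source) : ContinuousAt φ.toFun p :=
  φ.continuousOn_toFun.continuousAt (φ.open_source.mem_nhds hp)

/-- The set of points of the flow-box whose coordinates lie in the box `V × N`. -/
def box (φ : FlowBox k l S) (V : Set (Eu k)) (N : Set (Eu l)) : Set S :=
  φ.source ∩ φ.toFun ⁻¹' (V ×ˢ N)

lemma isOpen_box {V : Set (Eu k)} {N : Set (Eu l)} (hV : IsOpen V) (hN : IsOpen N) :
    IsOpen (φ.box V N) :=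
  φ.continuousOn_toFun.isOpen_inter_preimage φ.open_source (hV.prod hN)

/-- Every neighbourhood of a point of a flow-box contains a box around that point. -/
lemma exists_box_subset {p : S} (hp : p ∈ φ.source) {W : Set S} (hW : W ∈ 𝓝 p) :
    ∃ r > 0, Metric.ball (φ.toFun p).1 r ⊆ Metric.ball 0 1 ∧
      φ.box (Metric.ball (φ.toFun p).1 r) (Metric.ball (φ.toFun p).2 r) ⊆ W := by
  have h := φ.continuousOn_invFun (φ.toFun p) (toFun_mem hp)
  have hW' : W ∈ 𝓝 (φ.invFun (φ.toFun p)) := by rwa [inv_toFun hp]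
  obtain ⟨r, hr, hrW⟩ := Metric.mem_nhdsWithin_iff.1 (h hW')
  obtain ⟨r', hr', hrD⟩ := Metric.isOpen_iff.1 Metric.isOpen_ball _ (fst_mem hp)
  refine ⟨min r r', lt_min hr hr', (Metric.ball_subset_ball (min_le_right _ _)).trans hrD, ?_⟩
  rintro q ⟨hq, h1, h2⟩
  have hmem : φ.toFun q ∈ Metric.ball (φ.toFun p) r ∩ φ.target := by
    refine ⟨?_, toFun_mem hq⟩
    rw [← Prod.mk.eta (p := φ.toFun p), ← ball_prod_same]
    exact ⟨Metric.ball_subset_ball (min_le_left _ _) h1,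
      Metric.ball_subset_ball (min_le_left _ _) h2⟩
  have h3 : φ.invFun (φ.toFun q) ∈ W := hrW hmem
  rwa [inv_toFun hq] at h3

lemma box_mem_nhds {p : S} (hp : p ∈ φ.source) {V : Set (Eu k)} {N : Set (Eu l)}
    (hV : V ∈ 𝓝 (φ.toFun p).1) (hN : N ∈ 𝓝 (φ.toFun p).2) : φ.box V N ∈ 𝓝 p :=
  inter_mem (φ.open_source.mem_nhds hp) (continuousAt hp (prod_mem_nhds hV hN))

section Compact

variable [CompactSpace S] [T2Space S]

/-- The target of a flow-box is locally compact: small closed boxes in the target are compact. -/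
lemma exists_compact_box {x : Eu k} {y : Eu l} (hx : x ∈ Metric.ball (0 : Eu k) 1)
    (hy : y ∈ φ.transv) : ∃ r > 0, Metric.closedBall x r ⊆ Metric.ball 0 1 ∧
      IsCompact (Metric.closedBall y r ∩ φ.transv) := by
  set p := φ.invFun (x, y) with hp
  have hz := mk_mem_target hx hy
  have hpU : p ∈ φ.source := inv_mem hz
  have hpz : φ.toFun p = (x, y) := toFun_inv hz
  obtain ⟨C, hC, hCU, hCc⟩ := local_compact_nhds (φ.open_source.mem_nhds hpU)
  obtain ⟨r, hr, hrD, hrC⟩ := exists_box_subset hpU hC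
  rw [hpz] at hrD hrC
  refine ⟨r / 2, half_pos hr, (Metric.closedBall_subset_ball (half_lt_self hr)).trans hrD, ?_⟩
  have hA : IsCompact (φ.toFun '' C ∩ (Metric.closedBall x (r / 2) ×ˢ Metric.closedBall y (r / 2))) :=
    (hCc.image_of_continuousOn (φ.continuousOn_toFun.mono hCU)).inter_right
      (Metric.isClosed_closedBall.prod Metric.isClosed_closedBall)
  convert hA.image continuous_snd using 1
  ext y'
  constructor
  · rintro ⟨h1, h2⟩
    have hz' := mk_mem_target (φ := φ) hx h2
    refine ⟨(x, y'), ⟨⟨φ.invFun (x, y'), hrC ⟨inv_mem hz', ?_⟩, toFun_inv hz'⟩, ?_, h1⟩, rfl⟩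
    · rw [Set.mem_preimage, toFun_inv hz']
      exact ⟨Metric.mem_ball_self hr, Metric.closedBall_subset_ball (half_lt_self hr) h1⟩
    · exact Metric.mem_closedBall_self (half_pos hr).le
  · rintro ⟨z, ⟨⟨q, hq, rfl⟩, h1⟩, rfl⟩
    exact ⟨h1.2, snd_mem (hCU hq)⟩

/-- `K(U)` is an arbitrary subset of `ℝ^l` by definition, but `S` is compact Hausdorff, so `K(U)` is
locally compact; by the Lindelöf property it is a countable union of compact sets. -/
lemma measurableSet_transv : MeasurableSet φ.transv := by
  have h0 : (0 : Eu k) ∈ Metric.ball (0 : Eu k) 1 := by simp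
  have H : ∀ y : Eu l, ∃ N ∈ 𝓝 y, y ∈ φ.transv → MeasurableSet (N ∩ φ.transv) := by
    intro y
    by_cases hy : y ∈ φ.transv
    · obtain ⟨r, hr, -, h⟩ := exists_compact_box h0 hy
      exact ⟨_, Metric.closedBall_mem_nhds y hr, fun _ => h.isClosed.measurableSet⟩
    · exact ⟨Set.univ, univ_mem, fun h => absurd h hy⟩
  choose N hN hNm using H
  obtain ⟨t, hts, htc, ht⟩ := TopologicalSpace.countable_cover_nhdsWithin (f := N) (s := φ.transv)
    (fun y _ => mem_nhdsWithin_of_mem_nhds (hN y))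
  have : φ.transv = ⋃ y ∈ t, N y ∩ φ.transv := by
    rw [← Set.iUnion₂_inter, Set.inter_eq_right.2 ht]
  rw [this]
  exact MeasurableSet.biUnion htc fun y hy => hNm y (hts hy)

lemma measurableSet_target : MeasurableSet φ.target := by
  rw [φ.target_eq]
  exact Metric.isOpen_ball.measurableSet.prod measurableSet_transv

end Compact

lemma secondCountable_source : SecondCountableTopology φ.source := by
  let f : φ.source → φ.target := Set.MapsTo.restrict φ.toFun _ _ (fun _ h => toFun_mem h)
  let g : φ.target → φ.source := Set.MapsTo.restrict φ.invFun _ _ (fun _ h => inv_mem h)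
  have hf : IsEmbedding f := Function.LeftInverse.isEmbedding (f := g)
    (fun p => Subtype.ext (inv_toFun p.2))
    (φ.continuousOn_invFun.mapsToRestrict fun _ h => inv_mem h)
    (φ.continuousOn_toFun.mapsToRestrict fun _ h => toFun_mem h)
  exact hf.secondCountableTopology

/-- Flow-boxes that are compatible with the same atlas have changes of charts that preserve
local leaves. -/
lemma Compatible.transverse_trans {p : S} (h₁ : φ.Compatible χ) (h₂ : χ.Compatible ψ)
    (hφ : p ∈ φ.source) (hχ : p ∈ χ.source) (hψ : p ∈ ψ.source) :
    ∃ Y : Eu l → Eu l, ∀ᶠ q in 𝓝 p, (ψ.toFun q).2 = Y (φ.toFun q).2 := by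
  obtain ⟨Y₁, hY₁⟩ := h₁.transverse p ⟨hφ, hχ⟩
  obtain ⟨Y₂, hY₂⟩ := h₂.transverse p ⟨hχ, hψ⟩
  exact ⟨Y₂ ∘ Y₁, by filter_upwards [hY₁, hY₂] with q h1 h2; simp [h1, h2]⟩

/-- Moving along a local leaf: points with nearby leaf coordinate are close. -/
lemma tendsto_inv_mk {p : S} (hp : p ∈ φ.source) :
    Tendsto (fun x => φ.invFun (x, (φ.toFun p).2)) (𝓝 (φ.toFun p).1) (𝓝 p) := by
  have h := φ.continuousOn_invFun (φ.toFun p) (toFun_mem hp)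
  rw [ContinuousWithinAt] at h
  have hp' : 𝓝 p = 𝓝 (φ.invFun (φ.toFun p)) := by rw [inv_toFun hp]
  rw [hp']
  refine h.comp (tendsto_nhdsWithin_iff.2 ⟨?_, ?_⟩)
  · exact (Continuous.prodMk_left (φ.toFun p).2).tendsto' _ _ rfl
  · filter_upwards [Metric.isOpen_ball.mem_nhds (fst_mem hp)] with x hx
    exact mk_mem_target hx (snd_mem hp)

/-- Chain rule through the intermediate chart `χ`. It applies because the transverse coordinate of
`χ` is constant along a local leaf of `φ` near `p`, so the second change of charts is evaluated on
one fixed local leaf. -/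
lemma Compatible.differentiable_trans {p : S} (h₁ : φ.Compatible χ) (h₂ : χ.Compatible ψ)
    (hφ : p ∈ φ.source) (hχ : p ∈ χ.source) (hψ : p ∈ ψ.source) :
    DifferentiableAt ℝ (fun x => (ψ.toFun (φ.invFun (x, (φ.toFun p).2))).1) (φ.toFun p).1 := by
  obtain ⟨Y, hY⟩ := h₁.transverse p ⟨hφ, hχ⟩
  have d₁ := h₁.differentiable p ⟨hφ, hχ⟩
  have d₂ := h₂.differentiable p ⟨hχ, hψ⟩
  have ht := tendsto_inv_mk hφ
  have e : (fun x => (χ.toFun (φ.invFun (x, (φ.toFun p).2))).1) (φ.toFun p).1 = (χ.toFun p).1 := by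
    have : φ.invFun ((φ.toFun p).1, (φ.toFun p).2) = p := inv_toFun hφ
    simp only [this]
  rw [← e] at d₂
  refine (DifferentiableAt.comp (g := fun x => (ψ.toFun (χ.invFun (x, (χ.toFun p).2))).1)
    (f := fun x => (χ.toFun (φ.invFun (x, (φ.toFun p).2))).1) _ d₂ d₁).congr_of_eventuallyEq ?_
  filter_upwards [ht (χ.open_source.mem_nhds hχ), ht hY,
    Metric.isOpen_ball.mem_nhds (fst_mem hφ)] with x hx hxY hxD
  have h2 : (χ.toFun (φ.invFun (x, (φ.toFun p).2))).2 = (χ.toFun p).2 := by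
    have h3 : (χ.toFun (φ.invFun (x, (φ.toFun p).2))).2 =
      Y (φ.toFun (φ.invFun (x, (φ.toFun p).2))).2 := hxY
    rw [h3, toFun_inv (mk_mem_target hxD (snd_mem hφ)), hY.self_of_nhds]
  simp only [Function.comp]
  rw [← h2]
  congr 2
  exact (inv_toFun hx).symm

end FlowBox

/-! ### Changes between arbitrary flow-boxes; countability. -/

namespace Solenoid

variable {k l : ℕ} {S : Type*} [TopologicalSpace S] {𝓢 : Solenoid k l S} {φ ψ : FlowBox k l S}

lemma isFlowBox_of_mem_atlas (h : φ ∈ 𝓢.atlas) : 𝓢.IsFlowBox φ :=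
  fun ψ hψ => ⟨𝓢.compatible φ h ψ hψ, 𝓢.compatible ψ hψ φ h⟩

lemma exists_isFlowBox (𝓢 : Solenoid k l S) (p : S) : ∃ φ, 𝓢.IsFlowBox φ ∧ p ∈ φ.source := by
  obtain ⟨φ, h, hp⟩ := 𝓢.cover p
  exact ⟨φ, isFlowBox_of_mem_atlas h, hp⟩

lemma IsFlowBox.transverse (hφ : 𝓢.IsFlowBox φ) (hψ : 𝓢.IsFlowBox ψ) {p : S}
    (h₁ : p ∈ φ.source) (h₂ : p ∈ ψ.source) :
    ∃ Y : Eu l → Eu l, ∀ᶠ q in 𝓝 p, (ψ.toFun q).2 = Y (φ.toFun q).2 := by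
  obtain ⟨χ, hχ, hp⟩ := 𝓢.cover p
  exact (hφ χ hχ).1.transverse_trans (hψ χ hχ).2 h₁ hp h₂

lemma IsFlowBox.differentiableAt (hφ : 𝓢.IsFlowBox φ) (hψ : 𝓢.IsFlowBox ψ) {p : S}
    (h₁ : p ∈ φ.source) (h₂ : p ∈ ψ.source) :
    DifferentiableAt ℝ (fun x => (ψ.toFun (φ.invFun (x, (φ.toFun p).2))).1) (φ.toFun p).1 := by
  obtain ⟨χ, hχ, hp⟩ := 𝓢.cover p
  exact (hφ χ hχ).1.differentiable_trans (hψ χ hχ).2 h₁ hp h₂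

/-- Finitely many flow-boxes cover `S`, and each embeds in a Euclidean space. This is what allows
measures on `S` to be compared locally. -/
lemma secondCountableTopology [CompactSpace S] (𝓢 : Solenoid k l S) :
    SecondCountableTopology S := by
  choose φ hφ hp using 𝓢.exists_isFlowBox
  obtain ⟨t, ht⟩ := isCompact_univ.elim_finite_subcover (fun p => (φ p).source)
    (fun p => (φ p).open_source) (fun p _ => Set.mem_iUnion.2 ⟨p, hp p⟩)
  have (p : t) : SecondCountableTopology (φ p).source := FlowBox.secondCountable_source
  exact TopologicalSpace.secondCountableTopology_of_countable_cover (U := fun p : t => (φ p).source)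
    (fun p => (φ p).open_source) (Set.univ_subset_iff.1 (ht.trans fun x hx => by simpa using hx))

end Solenoid

/-! ### Borel sets in flow-boxes. -/

namespace FlowBox

variable {k l : ℕ} {S : Type*} [TopologicalSpace S] {φ ψ χ : FlowBox k l S}

lemma continuousOn_inv_mk {y : Eu l} (hy : y ∈ φ.transv) :
    ContinuousOn (fun x => φ.invFun (x, y)) (Metric.ball (0 : Eu k) 1) :=
  φ.continuousOn_invFun.comp (Continuous.prodMk_left y).continuousOn
    fun _ hx => mk_mem_target hx hy

variable [MeasurableSpace S] [BorelSpace S]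

lemma measurableSet_source : MeasurableSet φ.source := φ.open_source.measurableSet

lemma measurableSet_plaque {y : Eu l} (hy : y ∈ φ.transv) : MeasurableSet (φ.plaque y) := by
  have : φ.plaque y = φ.source ∩ φ.toFun ⁻¹' (Set.univ ×ˢ {y}) := by
    ext q; rw [mem_plaque hy]; simp
  rw [this]
  exact φ.continuousOn_toFun.measurableSet_inter_preimage' measurableSet_source
    (MeasurableSet.univ.prod (measurableSet_singleton y))

lemma measurableSet_transversal : MeasurableSet φ.transversal := by
  have : φ.transversal = φ.source ∩ φ.toFun ⁻¹' ({0} ×ˢ Set.univ) := by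
    ext q; rw [mem_transversal]; simp
  rw [this]
  exact φ.continuousOn_toFun.measurableSet_inter_preimage' measurableSet_source
    ((measurableSet_singleton 0).prod MeasurableSet.univ)

lemma measurableSet_ball_inter {y : Eu l} (hy : y ∈ φ.transv) {A : Set S} (hA : MeasurableSet A) :
    MeasurableSet (Metric.ball (0 : Eu k) 1 ∩ (fun x => φ.invFun (x, y)) ⁻¹' A) :=
  (continuousOn_inv_mk hy).measurableSet_inter_preimage' Metric.isOpen_ball.measurableSet hA

end FlowBox

open FlowBox

/-! ### Riemannian volume of local leaves and of leaves. -/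

namespace Solenoid.RiemannianMetric

variable {k l : ℕ} {S : Type*} [TopologicalSpace S] {𝓢 : Solenoid k l S}
  {φ ψ : FlowBox k l S} (G : 𝓢.RiemannianMetric)

/-- The metric in a flow-box, at a point, as a bilinear form. -/
def form (φ : FlowBox k l S) (z : Eu k × Eu l) : LinearMap.BilinForm ℝ (Eu k) :=
  (ContinuousLinearMap.coeLM ℝ).comp (G.g φ z).toLinearMap

lemma form_apply (z : Eu k × Eu l) (u v : Eu k) : G.form φ z u v = G.g φ z u v := rfl

lemma density_eq (z : Eu k × Eu l) : G.density φ z =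
    √(LinearMap.BilinForm.toMatrix (EuclideanSpace.basisFun (Fin k) ℝ).toBasis
      (G.form φ z)).det := by
  unfold density
  congr 2

lemma density_pos (hφ : 𝓢.IsFlowBox φ) {z : Eu k × Eu l} (hz : z ∈ φ.target) :
    0 < G.density φ z := by
  rw [density_eq]
  refine Real.sqrt_pos.2 (Matrix.PosDef.det_pos (Matrix.PosDef.of_dotProduct_mulVec_pos ?_ ?_))
  · ext i j
    simp [LinearMap.BilinForm.toMatrix_apply, form_apply, G.symm φ hφ z hz]
  · intro x hx
    rw [star_trivial, LinearMap.BilinForm.dotProduct_toMatrix_mulVec, form_apply]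
    exact G.pos φ hφ z hz _ (by simpa using hx)

lemma density_continuousOn (hφ : 𝓢.IsFlowBox φ) : ContinuousOn (G.density φ) φ.target := by
  unfold density
  refine (Continuous.comp_continuousOn (g := fun M : Matrix (Fin k) (Fin k) ℝ => √M.det)
    (Real.continuous_sqrt.comp continuous_id.matrix_det) ?_)
  refine continuousOn_pi.2 fun i => continuousOn_pi.2 fun j => ?_
  exact ((G.continuousOn φ hφ).clm_apply continuousOn_const).clm_apply continuousOn_const

/-- The Gram matrices are related by `Jᵀ g J`, so their determinants differ by the factor `(det
J)²`. -/
lemma density_change (hφ : 𝓢.IsFlowBox φ) (hψ : 𝓢.IsFlowBox ψ) {p : S} (h₁ : p ∈ φ.source)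
    (h₂ : p ∈ ψ.source) :
    G.density φ (φ.toFun p) = |(leafDeriv φ ψ p).det| * G.density ψ (ψ.toFun p) := by
  set b := (EuclideanSpace.basisFun (Fin k) ℝ).toBasis
  have h : G.form φ (φ.toFun p) = (G.form ψ (ψ.toFun p)).comp (leafDeriv φ ψ p).toLinearMap
      (leafDeriv φ ψ p).toLinearMap := by
    ext u v
    exact G.transform φ ψ hφ hψ p ⟨h₁, h₂⟩ u v
  rw [density_eq, density_eq, h, LinearMap.BilinForm.toMatrix_comp b b, Matrix.det_mul,
    Matrix.det_mul, Matrix.det_transpose, LinearMap.det_toMatrix, mul_right_comm, ← pow_two,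
    Real.sqrt_mul (sq_nonneg _), Real.sqrt_sq_eq_abs]

lemma isOpen_leafTopology_plaque (hφ : 𝓢.IsFlowBox φ) {y : Eu l} (hy : y ∈ φ.transv) :
    IsOpen[𝓢.leafTopology] (φ.plaque y) :=
  TopologicalSpace.isOpen_generateFrom_of_mem
    ⟨φ, hφ, y, hy, Metric.ball 0 1, Metric.isOpen_ball, subset_rfl, rfl⟩

lemma plaqueVol_le_leafVol [MeasurableSpace S] (hφ : 𝓢.IsFlowBox φ) {y : Eu l} (hy : y ∈ φ.transv) {L : Set S}
    (h : φ.plaque y ⊆ L) : G.plaqueVol φ y ≤ G.leafVol L := by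
  unfold leafVol
  exact le_iSup₂_of_le φ hφ (le_iSup₂_of_le y hy (le_iSup_of_le h le_rfl))

variable [MeasurableSpace S] [BorelSpace S]

lemma plaqueVol_apply {y : Eu l} (hy : y ∈ φ.transv) {A : Set S} (hA : MeasurableSet A) :
    G.plaqueVol φ y A = ∫⁻ x in Metric.ball (0 : Eu k) 1 ∩ (fun x => φ.invFun (x, y)) ⁻¹' A,
      ENNReal.ofReal (G.density φ (x, y)) := by
  unfold plaqueVol
  have h := (continuousOn_inv_mk hy).aemeasurable (μ := volume) Metric.isOpen_ball.measurableSet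
  rw [Measure.map_apply_of_aemeasurable (h.mono_ac (withDensity_absolutelyContinuous _ _)) hA,
    withDensity_apply', Measure.restrict_restrict₀ (h.nullMeasurableSet_preimage hA),
    Set.inter_comm]

lemma plaqueVol_inter_plaque {y : Eu l} (hy : y ∈ φ.transv) {A : Set S} (hA : MeasurableSet A) :
    G.plaqueVol φ y (A ∩ φ.plaque y) = G.plaqueVol φ y A := by
  rw [plaqueVol_apply G hy hA, plaqueVol_apply G hy (hA.inter (measurableSet_plaque hy))]
  congr 2
  ext x
  constructor
  · exact fun h => ⟨h.1, h.2.1⟩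
  · exact fun h => ⟨h.1, h.2, ⟨(x, y), Set.mk_mem_prod h.1 rfl, rfl⟩⟩

lemma plaqueVol_eq_zero {y : Eu l} (hy : y ∈ φ.transv) {A : Set S} (hA : MeasurableSet A)
    (h : Disjoint A (φ.plaque y)) : G.plaqueVol φ y A = 0 := by
  rw [← plaqueVol_inter_plaque G hy hA, h.inter_eq, measure_empty]

/-- The volumes of two local leaves agree on their intersection. -/
lemma plaqueVol_eq (hφ : 𝓢.IsFlowBox φ) (hψ : 𝓢.IsFlowBox ψ) {y z : Eu l} (hy : y ∈ φ.transv)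
    (hz : z ∈ ψ.transv) {A : Set S} (hA : MeasurableSet A) (h₁ : A ⊆ φ.plaque y)
    (h₂ : A ⊆ ψ.plaque z) : G.plaqueVol φ y A = G.plaqueVol ψ z A := by
  rw [plaqueVol_apply G hy hA, plaqueVol_apply G hz hA]
  set s := Metric.ball (0 : Eu k) 1 ∩ (fun x => φ.invFun (x, y)) ⁻¹' A with hs
  have hsm : MeasurableSet s := measurableSet_ball_inter hy hA
  set f : Eu k → Eu k := fun x => (ψ.toFun (φ.invFun (x, y))).1 with hf
  have key : ∀ x ∈ s, φ.invFun (x, y) ∈ φ.source ∧ φ.toFun (φ.invFun (x, y)) = (x, y) ∧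
      φ.invFun (x, y) ∈ ψ.source ∧ ψ.toFun (φ.invFun (x, y)) = (f x, z) := by
    intro x hx
    have ht := mk_mem_target (φ := φ) hx.1 hy
    have h := (mem_plaque hz).1 (h₂ hx.2)
    exact ⟨inv_mem ht, toFun_inv ht, h.1, Prod.ext rfl h.2⟩
  have himg : f '' s = Metric.ball (0 : Eu k) 1 ∩ (fun x => ψ.invFun (x, z)) ⁻¹' A := by
    ext x'
    constructor
    · rintro ⟨x, hx, rfl⟩
      obtain ⟨h1, h2, h3, h4⟩ := key x hx
      refine ⟨fst_mem h3, ?_⟩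
      rw [Set.mem_preimage, ← h4, inv_toFun h3]
      exact hx.2
    · rintro ⟨h1, h2⟩
      obtain ⟨h3, h4⟩ := (mem_plaque hy).1 (h₁ h2)
      have h5 : φ.invFun ((φ.toFun (ψ.invFun (x', z))).1, y) = ψ.invFun (x', z) := by
        rw [← h4]; exact inv_toFun h3
      refine ⟨(φ.toFun (ψ.invFun (x', z))).1, ⟨fst_mem h3, ?_⟩, ?_⟩
      · rw [Set.mem_preimage, h5]; exact h2
      · simp only [hf]
        rw [h5, toFun_inv (mk_mem_target h1 hz)]
  -- Change of variables along the leaf: the Jacobian is the factor provided by `density_change`.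
  rw [← himg, lintegral_image_eq_lintegral_abs_det_fderiv_mul volume hsm
    (f' := fun x => leafDeriv φ ψ (φ.invFun (x, y)))]
  · refine setLIntegral_congr_fun hsm fun x hx => ?_
    obtain ⟨h1, h2, h3, h4⟩ := key x hx
    have := density_change G hφ hψ h1 h3
    rw [h2, h4] at this
    rw [this, ENNReal.ofReal_mul (abs_nonneg _)]
  · intro x hx
    obtain ⟨h1, h2, h3, h4⟩ := key x hx
    have := (hφ.differentiableAt hψ h1 h3).hasFDerivAt
    rw [h2] at this
    have h5 : leafDeriv φ ψ (φ.invFun (x, y)) =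
        fderiv ℝ (fun x => (ψ.toFun (φ.invFun (x, y))).1) x := by
      unfold leafDeriv
      rw [h2]
    rw [h5]
    exact this.hasFDerivWithinAt
  · intro x hx x' hx' he
    obtain ⟨h1, h2, h3, h4⟩ := key x hx
    obtain ⟨h1', h2', h3', h4'⟩ := key x' hx'
    rw [he, ← h4'] at h4
    have h5 : φ.invFun (x, y) = φ.invFun (x', y) := by
      rw [← inv_toFun h3, ← inv_toFun h3', h4]
    rw [h5, h2'] at h2
    exact (congrArg Prod.fst h2).symm

/-- The volume of a leaf restricts to the volume of each of its local leaves. -/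
lemma leafVol_eq (hφ : 𝓢.IsFlowBox φ) {y : Eu l} (hy : y ∈ φ.transv) {L : Set S}
    (h : φ.plaque y ⊆ L) {A : Set S} (hA : MeasurableSet A) (hAy : A ⊆ φ.plaque y) :
    G.leafVol L A = G.plaqueVol φ y A := by
  have hP := measurableSet_plaque hy
  refine le_antisymm ?_ (plaqueVol_le_leafVol G hφ hy h A)
  -- To bound a supremum of measures it suffices to find one measure above all of them. `M` is
  -- infinite on nonempty sets off the local leaf, and on it equals `plaqueVol φ y`, with which
  -- every other `plaqueVol ψ z` agrees on the intersection.
  set M : Measure S := G.plaqueVol φ y + (⊤ : ENNReal) • (Measure.count.restrict (φ.plaque y)ᶜ)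
    with hM
  have hle : G.leafVol L ≤ M := by
    unfold leafVol
    refine iSup₂_le fun ψ hψ => iSup₂_le fun z hz => iSup_le fun _ => Measure.le_iff.2 fun B hB => ?_
    rw [← measure_inter_add_sdiff B hP]
    simp only [hM, Measure.add_apply, Measure.smul_apply, smul_eq_mul]
    refine add_le_add ?_ ?_
    · rw [← plaqueVol_inter_plaque G hz (hB.inter hP),
        ← plaqueVol_eq G hφ hψ hy hz ((hB.inter hP).inter (measurableSet_plaque hz))
        (fun q hq => hq.1.2) (fun q hq => hq.2)]
      exact measure_mono fun q hq => hq.1.1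
    · rw [Measure.restrict_apply hB, ← Set.sdiff_eq]
      rcases Set.eq_empty_or_nonempty (B \ φ.plaque y) with he | hne
      · simp [he]
      · have : Measure.count (B \ φ.plaque y) ≠ 0 := by
          rw [Ne, Measure.count_eq_zero_iff]; exact hne.ne_empty
        rw [ENNReal.top_mul this]
        exact le_top
  refine (hle A).trans ?_
  simp only [hM, Measure.add_apply, Measure.smul_apply, smul_eq_mul]
  rw [Measure.restrict_apply hA, ← Set.sdiff_eq, Set.sdiff_eq_empty.2 hAy]
  simp

lemma plaqueVol_plaque_pos (hφ : 𝓢.IsFlowBox φ) {y : Eu l} (hy : y ∈ φ.transv) :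
    0 < G.plaqueVol φ y (φ.plaque y) := by
  rw [← Set.univ_inter (φ.plaque y), plaqueVol_inter_plaque G hy MeasurableSet.univ,
    plaqueVol_apply G hy MeasurableSet.univ, Set.preimage_univ, Set.inter_univ]
  have hm : AEMeasurable (fun x => ENNReal.ofReal (G.density φ (x, y)))
      (volume.restrict (Metric.ball (0 : Eu k) 1)) :=
    ((density_continuousOn G hφ).comp (Continuous.prodMk_left y).continuousOn
      fun x hx => mk_mem_target hx hy).aemeasurable Metric.isOpen_ball.measurableSet |>.ennreal_ofReal
  rw [pos_iff_ne_zero, Ne, lintegral_eq_zero_iff' hm]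
  intro h
  rw [EventuallyEq, ae_restrict_iff' Metric.isOpen_ball.measurableSet] at h
  have h0 : volume (Metric.ball (0 : Eu k) 1) = 0 := by
    refine measure_mono_null (fun x hx => ?_) h
    simp only [Set.mem_compl_iff, Set.mem_ofPred_eq, Pi.zero_apply, ENNReal.ofReal_eq_zero]
    intro hcon
    exact absurd (density_pos G hφ (mk_mem_target hx hy)) (not_lt.2 (hcon hx))
  exact (Metric.measure_ball_pos volume (0 : Eu k) one_pos).ne' h0

/-- Compact subsets of a leaf have finite volume. -/
lemma leafVol_lt_top {L Q : Set S} (hL : 𝓢.IsLeaf L) (hQ : @IsCompact S 𝓢.leafTopology Q)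
    (hQL : Q ⊆ L) : G.leafVol L Q < ⊤ := by
  have H : ∀ p : S, ∃ W : Set S, IsOpen[𝓢.leafTopology] W ∧ p ∈ W ∧
      (p ∈ Q → G.leafVol L W < ⊤) := by
    intro p
    obtain ⟨φ, hφ, hp⟩ := 𝓢.exists_isFlowBox p
    have hy := snd_mem hp
    set y := (φ.toFun p).2
    have hc : ContinuousAt (fun x => G.density φ (x, y)) (φ.toFun p).1 :=
      ((density_continuousOn G hφ).comp (Continuous.prodMk_left y).continuousOn
      fun x hx => mk_mem_target hx hy).continuousAt (Metric.isOpen_ball.mem_nhds (fst_mem hp))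
    -- On this ball the density is less than its value at `p` plus one, so the corresponding disk
    -- has finite volume.
    obtain ⟨r, hr, hrb⟩ := Metric.mem_nhds_iff.1 (inter_mem
      (hc (Iio_mem_nhds (lt_add_one _))) (Metric.isOpen_ball.mem_nhds (fst_mem hp)))
    refine ⟨φ.invFun '' (Metric.ball (φ.toFun p).1 r ×ˢ {y}),
      TopologicalSpace.isOpen_generateFrom_of_mem ⟨φ, hφ, y, hy, Metric.ball _ r,
        Metric.isOpen_ball, fun x hx => (hrb hx).2, rfl⟩,
      ⟨φ.toFun p, ⟨Metric.mem_ball_self hr, rfl⟩, inv_toFun hp⟩, fun hpQ => ?_⟩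
    have hPL := hL.saturated φ hφ p ⟨hQL hpQ, hp⟩
    have hWeq : φ.invFun '' (Metric.ball (φ.toFun p).1 r ×ˢ {y}) =
        φ.source ∩ φ.toFun ⁻¹' (Metric.ball (φ.toFun p).1 r ×ˢ {y}) := by
      ext q
      constructor
      · rintro ⟨⟨x, y'⟩, ⟨hx, rfl⟩, rfl⟩
        have ht := mk_mem_target (φ := φ) (hrb hx).2 hy
        refine ⟨inv_mem ht, ?_⟩
        rw [Set.mem_preimage, toFun_inv ht]
        exact ⟨hx, rfl⟩
      · rintro ⟨h1, h2⟩
        exact ⟨_, h2, inv_toFun h1⟩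
    have hWm : MeasurableSet (φ.invFun '' (Metric.ball (φ.toFun p).1 r ×ˢ {y})) := by
      rw [hWeq]
      exact φ.continuousOn_toFun.measurableSet_inter_preimage' measurableSet_source
        (Metric.isOpen_ball.measurableSet.prod (measurableSet_singleton y))
    rw [leafVol_eq G hφ hy hPL hWm (Set.image_mono
      (Set.prod_mono (fun x hx => (hrb hx).2) subset_rfl)), plaqueVol_apply G hy hWm]
    have hsub : (Metric.ball (0 : Eu k) 1 ∩ (fun x => φ.invFun (x, y)) ⁻¹'
        (φ.invFun '' (Metric.ball (φ.toFun p).1 r ×ˢ {y}))) ⊆ Metric.ball (φ.toFun p).1 r := by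
      rintro x ⟨h1, h2⟩
      rw [hWeq] at h2
      have := h2.2
      rw [Set.mem_preimage, toFun_inv (mk_mem_target h1 hy)] at this
      exact this.1
    refine (lintegral_mono_set hsub).trans_lt ?_
    refine (setLIntegral_mono measurable_const (g := fun _ =>
      ENNReal.ofReal (G.density φ (φ.toFun p) + 1))
      fun x hx => ENNReal.ofReal_le_ofReal (le_of_lt (hrb hx).1)).trans_lt ?_
    rw [setLIntegral_const]
    exact ENNReal.mul_lt_top ENNReal.ofReal_lt_top measure_ball_lt_top
  choose W hWo hpW hWfin using H
  obtain ⟨t, ht⟩ := @IsCompact.elim_nhds_subcover' S 𝓢.leafTopology Q hQ (fun p _ => W p)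
    (fun p hp => @IsOpen.mem_nhds S 𝓢.leafTopology p (W p) (hWo p) (hpW p))
  refine (measure_mono ht).trans_lt ((measure_biUnion_finset_le t _).trans_lt ?_)
  exact ENNReal.sum_lt_top.2 fun p _ => hWfin p p.2

lemma leafVol_exhaustion_lt_top {L : Set S} {C : ℕ → Set S} (hL : 𝓢.IsLeaf L)
    (hC : 𝓢.IsExhaustion L C) (n : ℕ) : G.leafVol L (C n) < ⊤ := by
  obtain ⟨Q, hQ, hCQ, hQL⟩ := hC.relCompact n
  exact (measure_mono hCQ).trans_lt (leafVol_lt_top G hL hQ hQL)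

/-- The leaf contains a whole local leaf, of positive volume, and the volumes of the `C n` increase
to that of `L`. -/
lemma leafVol_exhaustion_pos {L : Set S} {C : ℕ → Set S} (hL : 𝓢.IsLeaf L)
    (hC : 𝓢.IsExhaustion L C) : ∀ᶠ n in atTop, 0 < G.leafVol L (C n) := by
  obtain ⟨p, hp⟩ := hL.connected.1
  obtain ⟨φ, hφ, hpφ⟩ := 𝓢.exists_isFlowBox p
  have hPL := hL.saturated φ hφ p ⟨hp, hpφ⟩
  have hpos : 0 < G.leafVol L L :=
    ((plaqueVol_plaque_pos G hφ (snd_mem hpφ)).trans_le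
      (plaqueVol_le_leafVol G hφ (snd_mem hpφ) hPL _)).trans_le (measure_mono hPL)
  have ht := tendsto_measure_iUnion_atTop (μ := G.leafVol L) hC.monotone
  rw [hC.iUnion_eq] at ht
  exact ht.eventually (lt_mem_nhds hpos)

end Solenoid.RiemannianMetric

/-! ### Gluing local products with Lebesgue measure. -/

section Locally

/-- Two measures that agree locally at the points of `s` agree on `s`. -/
lemma MeasureTheory.Measure.restrict_eq_of_locally {X : Type*} [TopologicalSpace X]
    [SecondCountableTopology X] [MeasurableSpace X] {μ ν : Measure X} {s : Set X}
    (h : ∀ x ∈ s, ∃ t ∈ 𝓝 x, μ.restrict t = ν.restrict t) : μ.restrict s = ν.restrict s := by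
  have h' : ∀ x, ∃ t ∈ 𝓝 x, x ∈ s → μ.restrict t = ν.restrict t := by
    intro x
    by_cases hx : x ∈ s
    · obtain ⟨t, ht, he⟩ := h x hx
      exact ⟨t, ht, fun _ => he⟩
    · exact ⟨Set.univ, univ_mem, fun h => absurd h hx⟩
  choose t ht he using h'
  obtain ⟨u, hus, huc, hu⟩ := TopologicalSpace.countable_cover_nhdsWithin (f := t) (s := s)
    (fun x _ => mem_nhdsWithin_of_mem_nhds (ht x))
  rw [← Measure.restrict_restrict_of_subset hu,
    (Measure.restrict_biUnion_congr huc).2 fun x hx => he x (hus hx),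
    Measure.restrict_restrict_of_subset hu]

variable {k l : ℕ}

/-- The neighbourhood `V` in the hypothesis depends on `y`; compactness of `C` makes it uniform. In
the inductive step `B` is cut into a part in the first piece and the rest, and the two constants add
up. -/
lemma exists_const_of_compact {M : Measure (Eu k × Eu l)} {K C : Set (Eu l)} (hCK : C ⊆ K)
    (hC : IsCompact C) {x : Eu k}
    (hM : ∀ y ∈ K, ∃ V ∈ 𝓝 x, ∃ N ∈ 𝓝 y, ∀ B ⊆ N, B ⊆ K → MeasurableSet B →
      ∃ c : ENNReal, ∀ A ⊆ V, MeasurableSet A → M (A ×ˢ B) = c * volume A) :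
    ∃ V ∈ 𝓝 x, ∀ B ⊆ C, MeasurableSet B →
      ∃ c : ENNReal, ∀ A ⊆ V, MeasurableSet A → M (A ×ˢ B) = c * volume A := by
  have key : ∃ V ∈ 𝓝 x, ∃ s', C ⊆ s' ∧ MeasurableSet s' ∧ ∀ B ⊆ s', B ⊆ K → MeasurableSet B →
      ∃ c : ENNReal, ∀ A ⊆ V, MeasurableSet A → M (A ×ˢ B) = c * volume A := by
    refine hC.induction_on (p := fun s => ∃ V ∈ 𝓝 x, ∃ s', s ⊆ s' ∧ MeasurableSet s' ∧
      ∀ B ⊆ s', B ⊆ K → MeasurableSet B →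
      ∃ c : ENNReal, ∀ A ⊆ V, MeasurableSet A → M (A ×ˢ B) = c * volume A) ?_ ?_ ?_ ?_
    · refine ⟨Set.univ, univ_mem, ∅, subset_rfl, MeasurableSet.empty, fun B hB _ _ => ⟨0, ?_⟩⟩
      intro A _ _
      simp [Set.subset_empty_iff.1 hB]
    · rintro s t hst ⟨V, hV, s', hs', h⟩
      exact ⟨V, hV, s', hst.trans hs', h⟩
    · rintro s t ⟨V₁, hV₁, s₁, hs₁, hm₁, h₁⟩ ⟨V₂, hV₂, s₂, hs₂, hm₂, h₂⟩
      refine ⟨V₁ ∩ V₂, inter_mem hV₁ hV₂, s₁ ∪ s₂, Set.union_subset_union hs₁ hs₂, hm₁.union hm₂,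
        fun B hB hBK hBm => ?_⟩
      obtain ⟨c₁, hc₁⟩ := h₁ (B ∩ s₁) Set.inter_subset_right (Set.inter_subset_left.trans hBK)
        (hBm.inter hm₁)
      obtain ⟨c₂, hc₂⟩ := h₂ (B \ s₁) (fun y hy => (hB hy.1).resolve_left hy.2)
        (Set.sdiff_subset.trans hBK) (hBm.diff hm₁)
      refine ⟨c₁ + c₂, fun A hA hAm => ?_⟩
      rw [← measure_inter_add_sdiff (A ×ˢ B) (MeasurableSet.univ.prod hm₁), add_mul,
        ← hc₁ A (fun a ha => (hA ha).1) hAm, ← hc₂ A (fun a ha => (hA ha).2) hAm]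
      congr 2
      · ext z; simp [and_assoc]
      · ext z; simp [and_assoc]
    · intro y hy
      obtain ⟨V, hV, N, hN, h⟩ := hM y (hCK hy)
      obtain ⟨N', hN', hN'o, hyN'⟩ := mem_nhds_iff.1 hN
      exact ⟨N', mem_nhdsWithin_of_mem_nhds (hN'o.mem_nhds hyN'), V, hV, N', subset_rfl,
        hN'o.measurableSet, fun B hB => h B (hB.trans hN')⟩
  obtain ⟨V, hV, s', hs', -, h⟩ := key
  exact ⟨V, hV, fun B hB hm => h B (hB.trans hs') (hB.trans hCK) hm⟩

/-- A measure on a connected set that is locally a multiple of Lebesgue measure is a multiple of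
Lebesgue measure. -/
lemma exists_const_of_preconnected {M : Measure (Eu k)} {D : Set (Eu k)} (hD : IsPreconnected D)
    (h : ∀ x ∈ D, ∃ V ∈ 𝓝 x, ∃ c : ENNReal, ∀ A ⊆ V, MeasurableSet A → M A = c * volume A) :
    ∃ c : ENNReal, M.restrict D = (c • volume).restrict D := by
  rcases D.eq_empty_or_nonempty with rfl | ⟨x₀, hx₀⟩
  · exact ⟨0, by simp⟩
  have h' : ∀ x, ∃ V : Set (Eu k), IsOpen V ∧ x ∈ V ∧ ∃ c : ENNReal, x ∈ D →
      ∀ A ⊆ V, MeasurableSet A → M A = c * volume A := by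
    intro x
    by_cases hx : x ∈ D
    · obtain ⟨V, hV, c, hc⟩ := h x hx
      obtain ⟨V', h1, h2, h3⟩ := mem_nhds_iff.1 hV
      exact ⟨V', h2, h3, c, fun _ A hA => hc A (hA.trans h1)⟩
    · exact ⟨Set.univ, isOpen_univ, trivial, 0, fun h => absurd h hx⟩
  choose V hVo hxV c hc using h'
  have hconst : ∀ x ∈ D, c x₀ = c x := by
    intro x hx
    refine hD.induction₂ (fun x y => c x = c y) ?_ (fun x y z _ _ _ h₁ h₂ => h₁.trans h₂)
      (fun x y _ _ h => h.symm) hx₀ hx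
    intro x hx
    filter_upwards [mem_nhdsWithin_of_mem_nhds ((hVo x).mem_nhds (hxV x)),
      self_mem_nhdsWithin] with y hy hyD
    -- On a ball inside both neighbourhoods the two constants multiply the same positive finite
    -- volume, so they are equal.
    obtain ⟨r, hr, hrb⟩ := Metric.mem_nhds_iff.1
      (((hVo x).inter (hVo y)).mem_nhds ⟨hy, hxV y⟩)
    have e := (hc x hx _ (fun z hz => (hrb hz).1) Metric.isOpen_ball.measurableSet).symm.trans
      (hc y hyD _ (fun z hz => (hrb hz).2) Metric.isOpen_ball.measurableSet)
    exact (ENNReal.mul_left_inj (Metric.measure_ball_pos volume y hr).ne' measure_ball_lt_top.ne).1 e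
  refine ⟨c x₀, Measure.restrict_eq_of_locally fun x hx => ⟨V x, (hVo x).mem_nhds (hxV x), ?_⟩⟩
  ext A hA
  rw [Measure.restrict_apply hA, Measure.restrict_apply hA,
    hc x hx _ Set.inter_subset_right (hA.inter (hVo x).measurableSet), ← hconst x hx]
  simp

/-- The transverse factor of a measure that is the product of Lebesgue measure on the unit ball
and of a measure on `ℝ^l`. -/
noncomputable def transverseFactor (M : Measure (Eu k × Eu l)) : Measure (Eu l) :=
  (volume (Metric.ball (0 : Eu k) (1 / 2)))⁻¹ •
    (M.restrict (Metric.ball (0 : Eu k) (1 / 2) ×ˢ Set.univ)).map Prod.snd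

lemma transverseFactor_apply (M : Measure (Eu k × Eu l)) {B : Set (Eu l)} (hB : MeasurableSet B) :
    transverseFactor M B = (volume (Metric.ball (0 : Eu k) (1 / 2)))⁻¹ *
      M (Metric.ball (0 : Eu k) (1 / 2) ×ˢ B) := by
  unfold transverseFactor
  rw [Measure.smul_apply, smul_eq_mul, Measure.map_apply measurable_snd hB,
    Measure.restrict_apply (measurable_snd hB)]
  congr 2
  ext z; simp [and_comm]

instance (M : Measure (Eu k × Eu l)) [SFinite M] : SFinite (transverseFactor M) := by
  unfold transverseFactor; infer_instance

variable {M : Measure (Eu k × Eu l)} {K : Set (Eu l)}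

lemma transverseFactor_compl (hK : MeasurableSet K)
    (hM : M (Metric.ball (0 : Eu k) 1 ×ˢ K)ᶜ = 0) : transverseFactor M Kᶜ = 0 := by
  rw [transverseFactor_apply M hK.compl, measure_mono_null (fun z hz hz' => hz.2 hz'.2) hM, mul_zero]

/-- For `B` in a small compact piece of `K`, `A ↦ M (A ×ˢ B)` is locally a multiple of Lebesgue
measure on the connected disk, hence globally one, and its constant is read off on the ball of
radius `1 / 2`. Then `A` is fixed, and the resulting equality of measures in `B` is local in `y`. -/
lemma measure_prod_of_locally (hK : MeasurableSet K)
    (hKc : ∀ y ∈ K, ∃ r > 0, IsCompact (Metric.closedBall y r ∩ K))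
    (hM : ∀ x ∈ Metric.ball (0 : Eu k) 1, ∀ y ∈ K, ∃ V ∈ 𝓝 x, ∃ N ∈ 𝓝 y, ∀ B ⊆ N, B ⊆ K →
      MeasurableSet B → ∃ c : ENNReal, ∀ A ⊆ V, MeasurableSet A → M (A ×ˢ B) = c * volume A)
    {A : Set (Eu k)} (hA : A ⊆ Metric.ball 0 1) (hAm : MeasurableSet A)
    {B : Set (Eu l)} (hB : B ⊆ K) (hBm : MeasurableSet B) :
    M (A ×ˢ B) = volume A * transverseFactor M B := by
  have small : ∀ y ∈ K, ∃ N ∈ 𝓝 y, MeasurableSet N ∧ ∀ B ⊆ N, B ⊆ K → MeasurableSet B →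
      M (A ×ˢ B) = volume A * transverseFactor M B := by
    intro y hy
    obtain ⟨r, hr, hc⟩ := hKc y hy
    refine ⟨_, Metric.closedBall_mem_nhds y hr, Metric.isClosed_closedBall.measurableSet,
      fun B hBN hBK hBm => ?_⟩
    have h1 : ∀ A : Set (Eu k), MeasurableSet A →
        ((M.restrict (Set.univ ×ˢ B)).map Prod.fst) A = M (A ×ˢ B) := by
      intro A hA
      rw [Measure.map_apply measurable_fst hA, Measure.restrict_apply (measurable_fst hA)]
      congr 1
      ext z; simp
    obtain ⟨c, hcM⟩ := exists_const_of_preconnected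
      (M := (M.restrict (Set.univ ×ˢ B)).map Prod.fst) (D := Metric.ball (0 : Eu k) 1)
      (convex_ball _ _).isPreconnected (fun x hx => by
        obtain ⟨V, hV, h⟩ := exists_const_of_compact Set.inter_subset_right hc (hM x hx)
        obtain ⟨c, hc⟩ := h B (Set.subset_inter hBN hBK) hBm
        exact ⟨V, hV, c, fun A hA hAm => by rw [h1 A hAm, hc A hA hAm]⟩)
    have h2 : ∀ A ⊆ Metric.ball (0 : Eu k) 1, MeasurableSet A → M (A ×ˢ B) = c * volume A := by
      intro A hA hAm
      rw [← h1 A hAm]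
      have := congrArg (fun m => m A) hcM
      simpa [Measure.restrict_apply hAm, Set.inter_eq_left.2 hA] using this
    have hb : Metric.ball (0 : Eu k) (1 / 2) ⊆ Metric.ball 0 1 :=
      Metric.ball_subset_ball (by norm_num)
    have hp : 0 < volume (Metric.ball (0 : Eu k) (1 / 2)) :=
      Metric.measure_ball_pos volume _ (by norm_num)
    rw [transverseFactor_apply M hBm, h2 A hA hAm, h2 _ hb Metric.isOpen_ball.measurableSet,
      mul_left_comm _ c, ENNReal.inv_mul_cancel hp.ne' measure_ball_lt_top.ne, mul_one, mul_comm]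
  have h1 : ∀ B : Set (Eu l), MeasurableSet B →
      ((M.restrict (A ×ˢ Set.univ)).map Prod.snd) B = M (A ×ˢ B) := by
    intro B hB
    rw [Measure.map_apply measurable_snd hB, Measure.restrict_apply (measurable_snd hB)]
    congr 1
    ext z; simp [and_comm]
  have h2 : (((M.restrict (A ×ˢ Set.univ)).map Prod.snd).restrict K).restrict K =
      ((volume A • transverseFactor M).restrict K).restrict K := by
    refine Measure.restrict_eq_of_locally fun y hy => ?_
    obtain ⟨N, hN, hNm, h⟩ := small y hy
    refine ⟨N, hN, ?_⟩
    ext B hB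
    rw [Measure.restrict_apply hB, Measure.restrict_apply hB, Measure.restrict_apply (hB.inter hNm),
      Measure.restrict_apply (hB.inter hNm), h1 _ ((hB.inter hNm).inter hK),
      h _ (fun z hz => hz.1.2) Set.inter_subset_right ((hB.inter hNm).inter hK)]
    rfl
  have := congrArg (fun m => m B) h2
  simpa [Measure.restrict_apply hBm, Set.inter_eq_left.2 hB, h1 B hBm] using this

/-- A measure on `D × K` which is locally a product of Lebesgue measure and of a transverse measure
is globally such a product. -/
lemma eq_prod_of_locally [SFinite M] (hK : MeasurableSet K)
    (hKc : ∀ y ∈ K, ∃ r > 0, IsCompact (Metric.closedBall y r ∩ K))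
    (hM0 : M (Metric.ball (0 : Eu k) 1 ×ˢ K)ᶜ = 0)
    (hfin : ∀ z ∈ Metric.ball (0 : Eu k) 1 ×ˢ K, ∃ W ∈ 𝓝 z, M W < ⊤)
    (hM : ∀ x ∈ Metric.ball (0 : Eu k) 1, ∀ y ∈ K, ∃ V ∈ 𝓝 x, ∃ N ∈ 𝓝 y, ∀ B ⊆ N, B ⊆ K →
      MeasurableSet B → ∃ c : ENNReal, ∀ A ⊆ V, MeasurableSet A → M (A ×ˢ B) = c * volume A) :
    M = (volume.restrict (Metric.ball (0 : Eu k) 1)).prod (transverseFactor M) := by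
  set D := Metric.ball (0 : Eu k) 1 with hD
  set ν := transverseFactor M with hν
  have hDm : MeasurableSet D := Metric.isOpen_ball.measurableSet
  have hνK : ν = ν.restrict K :=
    (Measure.restrict_eq_self_of_ae_mem (by
      rw [ae_iff]; exact transverseFactor_compl hK hM0)).symm
  have hMK : M = M.restrict (D ×ˢ K) :=
    (Measure.restrict_eq_self_of_ae_mem (by rw [ae_iff]; exact hM0)).symm
  have key : (M.restrict (D ×ˢ K)).restrict (D ×ˢ K) =
      ((volume.prod ν).restrict (D ×ˢ K)).restrict (D ×ˢ K) := by
    refine Measure.restrict_eq_of_locally fun z hz => ?_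
    obtain ⟨W, hW, hWf⟩ := hfin z hz
    obtain ⟨V, hV, N, hN, hVN⟩ := mem_nhds_prod_iff.1 hW
    obtain ⟨V', hV', hVo, hzV⟩ := mem_nhds_iff.1 hV
    obtain ⟨N', hN', hNo, hzN⟩ := mem_nhds_iff.1 hN
    refine ⟨V' ×ˢ N', prod_mem_nhds (hVo.mem_nhds hzV) (hNo.mem_nhds hzN), ?_⟩
    rw [Measure.restrict_restrict (hVo.measurableSet.prod hNo.measurableSet),
      Measure.restrict_restrict (hVo.measurableSet.prod hNo.measurableSet), Set.prod_inter_prod]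
    have : IsFiniteMeasure (M.restrict ((V' ∩ D) ×ˢ (N' ∩ K))) := ⟨by
      rw [Measure.restrict_apply_univ]
      refine (measure_mono ?_).trans_lt hWf
      exact (Set.prod_mono (Set.inter_subset_left.trans hV') (Set.inter_subset_left.trans hN')).trans
        hVN⟩
    -- Rectangles determine a finite measure. `M` need not be finite, which is why the comparison is
    -- made near each point.
    refine Measure.ext_prod fun {A B} hA hB => ?_
    rw [Measure.restrict_apply (hA.prod hB), Measure.restrict_apply (hA.prod hB),
      Set.prod_inter_prod, Measure.prod_prod]
    exact measure_prod_of_locally hK hKc hM (fun x hx => hx.2.2)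
      (hA.inter (hVo.measurableSet.inter hDm)) (fun x hx => hx.2.2)
      (hB.inter (hNo.measurableSet.inter hK))
  rw [Measure.restrict_restrict_of_subset subset_rfl,
    Measure.restrict_restrict_of_subset subset_rfl] at key
  rw [hνK, Measure.prod_restrict, ← key]
  exact hMK

end Locally

/-! ### Measures on `S` read in a chart and divided by the density. -/

namespace Solenoid.RiemannianMetric

variable {k l : ℕ} {S : Type*} [TopologicalSpace S] {𝓢 : Solenoid k l S}
  {φ ψ : FlowBox k l S} (G : 𝓢.RiemannianMetric)

/-- The Riemannian density of a flow-box, extended by zero outside the target. -/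
noncomputable def extDensity (φ : FlowBox k l S) : Eu k × Eu l → ENNReal :=
  φ.target.indicator fun z => ENNReal.ofReal (G.density φ z)

lemma extDensity_of_mem {z : Eu k × Eu l} (hz : z ∈ φ.target) :
    G.extDensity φ z = ENNReal.ofReal (G.density φ z) := Set.indicator_of_mem hz _

lemma extDensity_ne_top (z : Eu k × Eu l) : G.extDensity φ z ≠ ⊤ := by
  by_cases hz : z ∈ φ.target
  · rw [extDensity_of_mem G hz]; exact ENNReal.ofReal_ne_top
  · rw [extDensity, Set.indicator_of_notMem hz]; exact ENNReal.zero_ne_top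

lemma extDensity_ne_zero (hφ : 𝓢.IsFlowBox φ) {z : Eu k × Eu l} (hz : z ∈ φ.target) :
    G.extDensity φ z ≠ 0 := by
  rw [extDensity_of_mem G hz]
  exact (ENNReal.ofReal_pos.2 (density_pos G hφ hz)).ne'

lemma ae_mem_of_compl {ν : Measure (Eu l)} {K : Set (Eu l)} (hν : ν Kᶜ = 0) : ∀ᵐ y ∂ν, y ∈ K := by
  rw [ae_iff]; exact hν

lemma aemeasurable_toFun [MeasurableSpace S] [BorelSpace S] {μ : Measure S} : AEMeasurable φ.toFun (μ.restrict φ.source) :=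
  φ.continuousOn_toFun.aemeasurable measurableSet_source

lemma plaqueVol_eq_lintegral [MeasurableSpace S] [BorelSpace S] {y : Eu l} (hy : y ∈ φ.transv) {A : Set S} (hA : MeasurableSet A) :
    G.plaqueVol φ y A = ∫⁻ x in Metric.ball (0 : Eu k) 1,
      (φ.target ∩ φ.invFun ⁻¹' A).indicator (G.extDensity φ) (x, y) := by
  have hs := measurableSet_ball_inter hy hA
  rw [plaqueVol_apply G hy hA]
  set s := Metric.ball (0 : Eu k) 1 ∩ (fun x => φ.invFun (x, y)) ⁻¹' A
  have h : ∫⁻ x in Metric.ball (0 : Eu k) 1,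
      (φ.target ∩ φ.invFun ⁻¹' A).indicator (G.extDensity φ) (x, y) =
      ∫⁻ x in Metric.ball (0 : Eu k) 1,
        s.indicator (fun x => ENNReal.ofReal (G.density φ (x, y))) x := by
    refine setLIntegral_congr_fun Metric.isOpen_ball.measurableSet fun x hx => ?_
    have ht := mk_mem_target (φ := φ) hx hy
    by_cases hA' : φ.invFun (x, y) ∈ A
    · have h1 : (x, y) ∈ φ.target ∩ φ.invFun ⁻¹' A := ⟨ht, hA'⟩
      have h2 : x ∈ s := ⟨hx, hA'⟩
      rw [Set.indicator_of_mem h1, Set.indicator_of_mem h2, extDensity_of_mem G ht]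
    · have h1 : (x, y) ∉ φ.target ∩ φ.invFun ⁻¹' A := fun h => hA' h.2
      have h2 : x ∉ s := fun h => hA' h.2
      rw [Set.indicator_of_notMem h1, Set.indicator_of_notMem h2]
  rw [h, lintegral_indicator hs, Measure.restrict_restrict hs,
    Set.inter_eq_left.2 Set.inter_subset_left]

/-- `μ` is the integral of the volumes of the local leaves with respect to `ν`, on the subsets
of `W`. -/
def DisintegratesOn [MeasurableSpace S] (φ : FlowBox k l S) (μ : Measure S) (ν : Measure (Eu l)) (W : Set S) : Prop :=
  ∀ A : Set S, MeasurableSet A → A ⊆ W → μ A = ∫⁻ y, G.plaqueVol φ y A ∂ν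

lemma DisintegratesOn.mono [MeasurableSpace S] {μ : Measure S} {ν : Measure (Eu l)} {W W' : Set S} (h : G.DisintegratesOn φ μ ν W)
    (hW : W' ⊆ W) : G.DisintegratesOn φ μ ν W' := fun A hA hAW => h A hA (hAW.trans hW)

/-- The measure `μ` in the chart `φ`. -/
noncomputable def chartMeasure [MeasurableSpace S] (φ : FlowBox k l S) (μ : Measure S) : Measure (Eu k × Eu l) :=
  (μ.restrict φ.source).map φ.toFun

lemma chartMeasure_apply [MeasurableSpace S] [BorelSpace S] {μ : Measure S}
    {B : Set (Eu k × Eu l)} (hB : MeasurableSet B) :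
    chartMeasure φ μ B = μ (φ.source ∩ φ.toFun ⁻¹' B) := by
  unfold chartMeasure
  rw [Measure.map_apply_of_aemeasurable aemeasurable_toFun hB,
    Measure.restrict_apply₀ (aemeasurable_toFun.nullMeasurableSet_preimage hB), Set.inter_comm]

variable [CompactSpace S] [T2Space S]

lemma prod_compl_target {ν : Measure (Eu l)} [SFinite ν] (hν : ν φ.transvᶜ = 0) :
    ((volume.restrict (Metric.ball (0 : Eu k) 1)).prod ν) φ.targetᶜ = 0 := by
  have h : ν = ν.restrict φ.transv :=
    (Measure.restrict_eq_self_of_ae_mem (ae_mem_of_compl hν)).symm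
  have h2 := Measure.restrict_apply (μ := (volume : Measure (Eu k)).prod ν) (s := φ.target)
    (φ.measurableSet_target.compl)
  rw [h, Measure.prod_restrict, ← φ.target_eq, h2, Set.compl_inter_self, measure_empty]


lemma measurable_extDensity (hφ : 𝓢.IsFlowBox φ) : Measurable (G.extDensity φ) := by
  classical
  unfold extDensity
  rw [← Set.piecewise_eq_indicator]
  exact (ENNReal.continuous_ofReal.comp_continuousOn
    (density_continuousOn G hφ)).measurable_piecewise continuousOn_const measurableSet_target

variable [MeasurableSpace S]

/-- The measure `μ` in the chart `φ`, divided by the Riemannian density. -/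
noncomputable def flatten (φ : FlowBox k l S) (μ : Measure S) : Measure (Eu k × Eu l) :=
  (chartMeasure φ μ).withDensity fun z => (G.extDensity φ z)⁻¹

/-- The measure on the transversal (in the coordinates of `φ`) induced by `μ`. -/
noncomputable def transMeasure (φ : FlowBox k l S) (μ : Measure S) : Measure (Eu l) :=
  transverseFactor (G.flatten φ μ)

variable [BorelSpace S] {μ : Measure S}

lemma chartMeasure_compl : chartMeasure φ μ φ.targetᶜ = 0 := by
  rw [chartMeasure_apply measurableSet_target.compl]
  refine measure_mono_null (t := ∅) ?_ measure_empty
  rintro p ⟨h1, h2⟩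
  exact h2 (toFun_mem h1)

lemma flatten_compl : G.flatten φ μ φ.targetᶜ = 0 :=
  withDensity_absolutelyContinuous _ _ chartMeasure_compl

lemma flatten_withDensity (hφ : 𝓢.IsFlowBox φ) :
    (G.flatten φ μ).withDensity (G.extDensity φ) = chartMeasure φ μ := by
  have h : ∀ᵐ z ∂(chartMeasure φ μ), z ∈ φ.target := by
    rw [ae_iff]; exact chartMeasure_compl (φ := φ)
  -- The division can be undone: the density is finite everywhere and nonzero on the target, which
  -- carries the chart measure.
  have := withDensity_inv_same₀ (μ := chartMeasure φ μ) (f := fun z => (G.extDensity φ z)⁻¹)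
    (measurable_extDensity G hφ).inv.aemeasurable
    (Eventually.of_forall fun z => ENNReal.inv_ne_zero.2 (extDensity_ne_top G z))
    (h.mono fun z hz => ENNReal.inv_ne_top.2 (extDensity_ne_zero G hφ hz))
  unfold flatten
  convert this using 2
  ext z
  simp

instance [IsFiniteMeasure μ] : IsFiniteMeasure (chartMeasure φ μ) := by
  unfold chartMeasure; infer_instance

instance [IsFiniteMeasure μ] : SFinite (G.flatten φ μ) := by
  unfold flatten; infer_instance

instance [IsFiniteMeasure μ] : SFinite (G.transMeasure φ μ) := by
  unfold transMeasure; infer_instance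

lemma flatten_locally_finite [IsFiniteMeasure μ] (hφ : 𝓢.IsFlowBox φ) {z : Eu k × Eu l}
    (hz : z ∈ φ.target) : ∃ W ∈ 𝓝 z, G.flatten φ μ W < ⊤ := by
  have hc := density_continuousOn G hφ z hz
  have hpos := density_pos G hφ hz
  obtain ⟨W, hWo, hzW, hW⟩ := mem_nhdsWithin.1 (hc (Ioi_mem_nhds (half_lt_self hpos)))
  refine ⟨W, hWo.mem_nhds hzW, ?_⟩
  rw [← measure_inter_add_sdiff W φ.measurableSet_target, measure_mono_null (s := W \ φ.target) (t := φ.targetᶜ)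
    (fun z hz => hz.2) (flatten_compl G (μ := μ)), add_zero]
  unfold flatten
  rw [withDensity_apply _ (hWo.measurableSet.inter φ.measurableSet_target)]
  refine (setLIntegral_mono measurable_const
    (g := fun _ => (ENNReal.ofReal (G.density φ z / 2))⁻¹) fun x hx => ?_).trans_lt ?_
  · rw [extDensity_of_mem G hx.2]
    exact ENNReal.inv_le_inv.2 (ENNReal.ofReal_le_ofReal (le_of_lt (hW hx)))
  · rw [setLIntegral_const]
    exact ENNReal.mul_lt_top (ENNReal.inv_lt_top.2 (ENNReal.ofReal_pos.2 (half_pos hpos)))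
      (measure_lt_top _ _)

lemma measurableSet_chartImage {A : Set S} (hA : MeasurableSet A) :
    MeasurableSet (φ.target ∩ φ.invFun ⁻¹' A) :=
  φ.continuousOn_invFun.measurableSet_inter_preimage' measurableSet_target hA

/-- The volume of the slices of a Borel set is a measurable function on the transversal. -/
lemma exists_measurable_plaqueVol (hφ : 𝓢.IsFlowBox φ) {A : Set S} (hA : MeasurableSet A) :
    ∃ F : Eu l → ENNReal, Measurable F ∧ ∀ y ∈ φ.transv, G.plaqueVol φ y A = F y :=
  ⟨_, Measurable.lintegral_prod_left' ((measurable_extDensity G hφ).indicator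
    (measurableSet_chartImage hA)), fun _ hy => plaqueVol_eq_lintegral G hy hA⟩

variable {ν : Measure (Eu l)}

/-- Tonelli: integrating volumes of slices against `ν` is integrating the density against Lebesgue
measure times `ν`. -/
lemma lintegral_plaqueVol [SFinite ν] (hφ : 𝓢.IsFlowBox φ) (hν : ν φ.transvᶜ = 0) {A : Set S}
    (hA : MeasurableSet A) : ∫⁻ y, G.plaqueVol φ y A ∂ν =
      ∫⁻ z in φ.target ∩ φ.invFun ⁻¹' A, G.extDensity φ z
        ∂((volume.restrict (Metric.ball (0 : Eu k) 1)).prod ν) := by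
  have hm := (measurable_extDensity G hφ).indicator (measurableSet_chartImage (φ := φ) hA)
  rw [lintegral_congr_ae ((ae_mem_of_compl hν).mono fun y hy => plaqueVol_eq_lintegral G hy hA),
    ← lintegral_indicator (measurableSet_chartImage hA), lintegral_prod_symm _ hm.aemeasurable]

/-- By `lintegral_plaqueVol`, a disintegration says that on the box the chart measure has the
Riemannian density with respect to the product; dividing by the density leaves the product. -/
lemma flatten_restrict_eq [SFinite ν] (hφ : 𝓢.IsFlowBox φ) (hν : ν φ.transvᶜ = 0)
    {V : Set (Eu k)} {N : Set (Eu l)} (hV : MeasurableSet V) (hN : MeasurableSet N)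
    (h : G.DisintegratesOn φ μ ν (φ.box V N)) :
    (G.flatten φ μ).restrict (V ×ˢ N) =
      ((volume.restrict (Metric.ball (0 : Eu k) 1)).prod ν).restrict (V ×ˢ N) := by
  set P := (volume.restrict (Metric.ball (0 : Eu k) 1)).prod ν
  have hVN : MeasurableSet (V ×ˢ N) := hV.prod hN
  set T := (V ×ˢ N) ∩ φ.target with hT
  have hTm : MeasurableSet T := hVN.inter measurableSet_target
  have h1 : (chartMeasure φ μ).restrict T = (P.restrict T).withDensity (G.extDensity φ) := by
    ext B hB
    have hBT := hB.inter hTm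
    rw [Measure.restrict_apply hB, chartMeasure_apply hBT,
      h _ (φ.continuousOn_toFun.measurableSet_inter_preimage' measurableSet_source hBT)
      (fun q hq => ⟨hq.1, hq.2.2.1⟩), lintegral_plaqueVol G hφ hν
      (φ.continuousOn_toFun.measurableSet_inter_preimage' measurableSet_source hBT),
      withDensity_apply _ hB, Measure.restrict_restrict hB]
    congr 2
    ext z
    constructor
    · rintro ⟨h1, h2, h3⟩
      rwa [Set.mem_preimage, toFun_inv h1] at h3
    · intro hz
      refine ⟨hz.2.2, inv_mem hz.2.2, ?_⟩
      rwa [Set.mem_preimage, toFun_inv hz.2.2]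
  have h2 : (G.flatten φ μ).restrict T = P.restrict T := by
    unfold flatten
    rw [restrict_withDensity hTm, h1]
    refine withDensity_inv_same₀ (measurable_extDensity G hφ).aemeasurable ?_
      (Eventually.of_forall fun z => extDensity_ne_top G z)
    rw [ae_restrict_iff' hTm]
    exact Eventually.of_forall fun z hz => extDensity_ne_zero G hφ hz.2
  have h3 : ∀ M : Measure (Eu k × Eu l), M φ.targetᶜ = 0 →
      M.restrict (V ×ˢ N) = M.restrict T := by
    intro M hM
    refine (Measure.restrict_congr_set ?_).symm
    have : ∀ᵐ z ∂M, z ∈ φ.target := by rw [ae_iff]; exact hM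
    filter_upwards [this] with z hz
    exact propext ⟨fun h => h.1, fun h => ⟨h, hz⟩⟩
  rw [h3 _ (flatten_compl G), h2, h3 _ (prod_compl_target hν)]

/-- The converse of `flatten_restrict_eq`, on the whole flow-box: multiply the product by the
density and apply Tonelli. -/
lemma disintegratesOn_of_flatten [SFinite ν] (hφ : 𝓢.IsFlowBox φ) (hν : ν φ.transvᶜ = 0)
    (h : G.flatten φ μ = (volume.restrict (Metric.ball (0 : Eu k) 1)).prod ν) :
    G.DisintegratesOn φ μ ν φ.source := by
  intro A hA hAU
  rw [lintegral_plaqueVol G hφ hν hA, ← h,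
    ← withDensity_apply _ (measurableSet_chartImage hA), flatten_withDensity G hφ,
    chartMeasure_apply (measurableSet_chartImage hA)]
  congr 1
  ext q
  constructor
  · intro hq
    refine ⟨hAU hq, toFun_mem (hAU hq), ?_⟩
    rwa [Set.mem_preimage, inv_toFun (hAU hq)]
  · rintro ⟨h1, h2, h3⟩
    rwa [Set.mem_preimage, inv_toFun h1] at h3

end Solenoid.RiemannianMetric

/-! ### Recognizing products by functions of zero mean along the disk. -/

section Cutoff

variable {n : ℕ}

/-- A continuous function which is `1` on the ball of radius `r / 2` about `c` and vanishes outside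
the ball of radius `r`. -/
noncomputable def cutoff (c : Eu n) (r : ℝ) (x : Eu n) : ℝ := max 0 (min 1 (2 - 2 * dist x c / r))

lemma continuous_cutoff (c : Eu n) (r : ℝ) : Continuous (cutoff c r) := by
  unfold cutoff; fun_prop

lemma cutoff_nonneg (c : Eu n) (r : ℝ) (x : Eu n) : 0 ≤ cutoff c r x := le_max_left _ _

lemma cutoff_le_one (c : Eu n) (r : ℝ) (x : Eu n) : cutoff c r x ≤ 1 :=
  max_le zero_le_one (min_le_left _ _)

lemma cutoff_eq_one {c : Eu n} {r : ℝ} (hr : 0 < r) {x : Eu n} (hx : x ∈ Metric.ball c (r / 2)) :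
    cutoff c r x = 1 := by
  have h : dist x c < r / 2 := hx
  have h2 : 2 * dist x c / r ≤ 1 := by rw [div_le_one hr]; linarith
  unfold cutoff
  rw [min_eq_left (by linarith), max_eq_right zero_le_one]

lemma cutoff_eq_zero {c : Eu n} {r : ℝ} (hr : 0 < r) {x : Eu n} (hx : x ∉ Metric.closedBall c r) :
    cutoff c r x = 0 := by
  have h : r < dist x c := not_le.1 hx
  have h2 : 2 ≤ 2 * dist x c / r := by rw [le_div_iff₀ hr]; linarith
  unfold cutoff
  rw [max_eq_left]
  exact (min_le_right _ _).trans (by linarith)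

lemma hasCompactSupport_cutoff {c : Eu n} {r : ℝ} (hr : 0 < r) : HasCompactSupport (cutoff c r) :=
  HasCompactSupport.intro (isCompact_closedBall c r) fun _ hx => cutoff_eq_zero hr hx

lemma integral_cutoff_pos {c : Eu n} {r : ℝ} (hr : 0 < r) : 0 < ∫ x, cutoff c r x := by
  refine (continuous_cutoff c r).integral_pos_of_hasCompactSupport_nonneg_nonzero
    (hasCompactSupport_cutoff hr) (cutoff_nonneg c r) (x := c) ?_
  rw [cutoff_eq_one hr (Metric.mem_ball_self (half_pos hr))]
  exact one_ne_zero

variable {k l : ℕ} {M : Measure (Eu k × Eu l)}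

/-- A measure which kills the products `a(x) b(y)` with `∫ a = 0` supported in a box is, on a
smaller box, a product of Lebesgue measure and of a transverse measure. -/
lemma exists_const_of_integral_eq_zero {x₀ : Eu k} {y₀ : Eu l} {r : ℝ} (hr : 0 < r)
    (hfin : M (Metric.closedBall x₀ r ×ˢ Metric.closedBall y₀ r) < ⊤)
    (hM : ∀ (a : Eu k → ℝ) (b : Eu l → ℝ), Continuous a → Continuous b →
      (∀ x ∉ Metric.closedBall x₀ r, a x = 0) → (∀ y ∉ Metric.closedBall y₀ r, b y = 0) →
      ∫ x, a x = 0 → ∫ z, a z.1 * b z.2 ∂M = 0)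
    {B : Set (Eu l)} (hB : B ⊆ Metric.ball y₀ (r / 2)) (hBm : MeasurableSet B) :
    ∃ c : ENNReal, ∀ A ⊆ Metric.ball x₀ (r / 2), MeasurableSet A → M (A ×ˢ B) = c * volume A := by
  set u := cutoff x₀ r with hu
  set g := cutoff y₀ r with hg
  have huc : Continuous u := continuous_cutoff _ _
  have hgc : Continuous g := continuous_cutoff _ _
  set Q := Metric.closedBall x₀ r ×ˢ Metric.closedBall y₀ r with hQ
  have hQm : MeasurableSet Q :=
    (Metric.isClosed_closedBall.prod Metric.isClosed_closedBall).measurableSet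
  have hw0 : ∀ z ∉ Q, u z.1 * g z.2 = 0 := by
    intro z hz
    by_cases h1 : z.1 ∈ Metric.closedBall x₀ r
    · rw [hg, cutoff_eq_zero hr (fun h2 => hz ⟨h1, h2⟩), mul_zero]
    · rw [hu, cutoff_eq_zero hr h1, zero_mul]
  have hw1 : ∀ z : Eu k × Eu l, 0 ≤ u z.1 * g z.2 := fun z =>
    mul_nonneg (cutoff_nonneg _ _ _) (cutoff_nonneg _ _ _)
  have hw2 : ∀ z : Eu k × Eu l, u z.1 * g z.2 ≤ 1 := fun z =>
    mul_le_one₀ (cutoff_le_one _ _ _) (cutoff_nonneg _ _ _) (cutoff_le_one _ _ _)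
  have hwc : Continuous fun z : Eu k × Eu l => u z.1 * g z.2 := by fun_prop
  -- The weight `u g` makes the measure finite, so that it is determined by products of bounded
  -- continuous functions. It equals `1` on the smaller box, where `M'` is therefore still `M`.
  set M' := M.withDensity fun z => ENNReal.ofReal (u z.1 * g z.2) with hM'
  have hM'fin : IsFiniteMeasure M' := by
    refine isFiniteMeasure_withDensity (ne_of_lt ?_)
    calc ∫⁻ z, ENNReal.ofReal (u z.1 * g z.2) ∂M ≤ ∫⁻ z, Q.indicator 1 z ∂M := by
          refine lintegral_mono fun z => ?_
          by_cases hz : z ∈ Q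
          · rw [Set.indicator_of_mem hz]
            simpa using hw2 z
          · simp [hw0 z hz]
      _ = M Q := by rw [lintegral_indicator_one hQm]
      _ < ⊤ := hfin
  set I := ∫ x, u x with hI
  have hIpos : 0 < I := integral_cutoff_pos hr
  -- In a product `μ₀.prod ν` the second marginal is `I` times `ν`, as `μ₀` has total mass `I`.
  set ν := (ENNReal.ofReal I⁻¹) • M'.map Prod.snd with hν
  have hνfin : IsFiniteMeasure ν := by
    rw [hν]
    exact Measure.smul_finite _ ENNReal.ofReal_ne_top
  have huint : Integrable u := huc.integrable_of_hasCompactSupport (hasCompactSupport_cutoff hr)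
  set μ₀ := (volume : Measure (Eu k)).withDensity fun x => ENNReal.ofReal (u x) with hμ₀
  have hμfin : IsFiniteMeasure μ₀ := by
    refine isFiniteMeasure_withDensity (ne_of_lt ?_)
    rw [← ofReal_integral_eq_lintegral_ofReal huint (Eventually.of_forall (cutoff_nonneg _ _))]
    exact ENNReal.ofReal_lt_top
  have hintM' : ∀ F : Eu k × Eu l → ℝ, ∫ z, F z ∂M' = ∫ z, (u z.1 * g z.2) * F z ∂M := by
    intro F
    rw [hM', integral_withDensity_eq_integral_toReal_smul hwc.measurable.ennreal_ofReal
      (Eventually.of_forall fun _ => ENNReal.ofReal_lt_top)]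
    refine integral_congr_ae (Eventually.of_forall fun z => ?_)
    simp only [ENNReal.toReal_ofReal (hw1 z), smul_eq_mul]
  have hintμ : ∀ F : Eu k → ℝ, ∫ x, F x ∂μ₀ = ∫ x, u x * F x := by
    intro F
    rw [hμ₀, integral_withDensity_eq_integral_toReal_smul huc.measurable.ennreal_ofReal
      (Eventually.of_forall fun _ => ENNReal.ofReal_lt_top)]
    refine integral_congr_ae (Eventually.of_forall fun z => ?_)
    simp only [ENNReal.toReal_ofReal (cutoff_nonneg x₀ r z), hu, smul_eq_mul]
  have hprod : M' = μ₀.prod ν := by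
    refine Measure.eq_prod_of_integral_mul_boundedContinuousFunction fun F H => ?_
    rw [hintM', hintμ, hν, integral_smul_measure,
      integral_map measurable_snd.aemeasurable H.continuous.aestronglyMeasurable, hintM',
      ENNReal.toReal_ofReal (inv_nonneg.2 hIpos.le), smul_eq_mul]
    set J := ∫ x, u x * F x with hJ
    have hint : ∀ P : Eu k × Eu l → ℝ, Continuous P → (∃ C, ∀ z, |P z| ≤ C) →
        Integrable (fun z => (u z.1 * g z.2) * P z) M := by
      rintro P hPc ⟨C, hC⟩
      have : IntegrableOn (fun z => (u z.1 * g z.2) * P z) Q M := by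
        refine IntegrableOn.of_bound hfin (hwc.mul hPc).aestronglyMeasurable C
          (Eventually.of_forall fun z => ?_)
        rw [Real.norm_eq_abs, abs_mul, abs_of_nonneg (hw1 z)]
        exact (mul_le_of_le_one_left (abs_nonneg _) (hw2 z)).trans (hC z)
      exact (integrableOn_iff_integrable_of_support_subset fun z hz => by
        by_contra hzQ
        exact hz (by simp [hw0 z hzQ])).1 this
    -- Subtracting the multiple `J / I` of `u` gives `u F` mean zero. That this test function is
    -- killed says `∫ F H dM' = (J / I) ∫ H dM'`, which is the product formula.
    have h0 := hM (fun x => u x * F x - J * I⁻¹ * u x) (fun y => g y * H y)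
      (by fun_prop) (by fun_prop)
      (fun x hx => by simp [hu, cutoff_eq_zero hr hx]) (fun y hy => by simp [hg, cutoff_eq_zero hr hy])
      (by
        rw [integral_sub, integral_const_mul, ← hJ, ← hI]
        · field_simp; ring
        · exact (huint.mul_bdd (c := ‖F‖) F.continuous.aestronglyMeasurable
            (Eventually.of_forall F.norm_coe_le_norm))
        · exact huint.const_mul _)
    have i1 := hint (fun z => F z.1 * H z.2) (by fun_prop) ⟨‖F‖ * ‖H‖, fun z => by
      rw [abs_mul]
      exact mul_le_mul (F.norm_coe_le_norm _) (H.norm_coe_le_norm _) (abs_nonneg _) (norm_nonneg _)⟩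
    have i2 := hint (fun z => H z.2) (by fun_prop) ⟨‖H‖, fun z => H.norm_coe_le_norm _⟩
    have e : ∫ z, (u z.1 * F z.1 - J * I⁻¹ * u z.1) * (g z.2 * H z.2) ∂M =
        ∫ z, u z.1 * g z.2 * (F z.1 * H z.2) ∂M - J * I⁻¹ * ∫ z, u z.1 * g z.2 * H z.2 ∂M := by
      rw [← integral_const_mul, ← integral_sub i1 (i2.const_mul _)]
      congr 1
      ext z
      ring
    rw [e] at h0
    linarith
  refine ⟨ν B, fun A hA hAm => ?_⟩
  have h1 : M' (A ×ˢ B) = M (A ×ˢ B) := by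
    rw [hM', withDensity_apply _ (hAm.prod hBm), setLIntegral_congr_fun (hAm.prod hBm)
      (g := fun _ => 1), setLIntegral_one]
    intro z hz
    simp [hu, hg, cutoff_eq_one hr (hA hz.1), cutoff_eq_one hr (hB hz.2)]
  have h2 : μ₀ A = volume A := by
    rw [hμ₀, withDensity_apply _ hAm, setLIntegral_congr_fun hAm
      (g := fun _ => 1), setLIntegral_one]
    intro x hx
    simp [hu, cutoff_eq_one hr (hA hx)]
  rw [← h1, hprod, Measure.prod_prod, h2, mul_comm]

end Cutoff

/-! ### Controlled growth: limits of normalized volumes are locally products. -/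

namespace Solenoid.RiemannianMetric

variable {k l : ℕ} {S : Type*} [TopologicalSpace S] {𝓢 : Solenoid k l S}
  {φ ψ : FlowBox k l S} (G : 𝓢.RiemannianMetric)

lemma fullPart_subset {C : Set S} : fullPart φ C ⊆ C ∩ φ.source :=
  Set.iUnion₂_subset fun _ hy => Set.subset_inter hy.2 (plaque_subset_source hy.1)

/-- The function is supported in the image of a compact box of the target, which is closed in `S`,
so its extension by zero stays continuous. Dividing by the density turns integrals for the
Riemannian volume into Lebesgue integrals of `a`. -/
lemma exists_test_function [T2Space S] (hφ : 𝓢.IsFlowBox φ) {x₀ : Eu k} {y₀ : Eu l} {r : ℝ}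
    (hx : Metric.closedBall x₀ r ⊆ Metric.ball 0 1)
    (hy : IsCompact (Metric.closedBall y₀ r ∩ φ.transv))
    {a : Eu k → ℝ} {b : Eu l → ℝ} (ha : Continuous a) (hb : Continuous b)
    (ha0 : ∀ x ∉ Metric.closedBall x₀ r, a x = 0) (hb0 : ∀ y ∉ Metric.closedBall y₀ r, b y = 0) :
    ∃ f : S → ℝ, Continuous f ∧ (∀ p ∉ φ.source, f p = 0) ∧
      ∀ p ∈ φ.source, f p = (G.density φ (φ.toFun p))⁻¹ * (a (φ.toFun p).1 * b (φ.toFun p).2) := by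
  classical
  set F : S → ℝ := fun p => (G.density φ (φ.toFun p))⁻¹ * (a (φ.toFun p).1 * b (φ.toFun p).2)
  have hF : ContinuousOn F φ.source := by
    have h1 : ContinuousOn (fun p => G.density φ (φ.toFun p)) φ.source :=
      (density_continuousOn G hφ).comp φ.continuousOn_toFun fun _ hp => toFun_mem hp
    refine (h1.inv₀ fun p hp => (density_pos G hφ (toFun_mem hp)).ne').mul (ContinuousOn.mul ?_ ?_)
    · exact (ha.comp continuous_fst).comp_continuousOn φ.continuousOn_toFun
    · exact (hb.comp continuous_snd).comp_continuousOn φ.continuousOn_toFun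
  set Q := Metric.closedBall x₀ r ×ˢ (Metric.closedBall y₀ r ∩ φ.transv) with hQ
  have hQt : Q ⊆ φ.target := fun z hz => mem_target.2 ⟨hx hz.1, hz.2.2⟩
  have hQc : IsClosed (φ.invFun '' Q) :=
    (((isCompact_closedBall x₀ r).prod hy).image_of_continuousOn
      (φ.continuousOn_invFun.mono hQt)).isClosed
  have hz : ∀ p ∉ φ.invFun '' Q, φ.source.indicator F p = 0 := by
    intro p hp
    by_cases hpU : p ∈ φ.source
    · rw [Set.indicator_of_mem hpU]
      simp only [F]
      by_cases h1 : (φ.toFun p).1 ∈ Metric.closedBall x₀ r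
      · rw [hb0 _ fun h2 => hp ⟨φ.toFun p, ⟨h1, h2, snd_mem hpU⟩, inv_toFun hpU⟩, mul_zero, mul_zero]
      · rw [ha0 _ h1, zero_mul, mul_zero]
    · exact Set.indicator_of_notMem hpU _
  refine ⟨φ.source.indicator F, continuous_iff_continuousAt.2 fun p => ?_,
    fun p hp => Set.indicator_of_notMem hp _, fun p hp => Set.indicator_of_mem hp _⟩
  by_cases hp : p ∈ φ.source
  · refine (hF.continuousAt (φ.open_source.mem_nhds hp)).congr ?_
    filter_upwards [φ.open_source.mem_nhds hp] with q hq
    exact (Set.indicator_of_mem hq _).symm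
  · have hpQ : p ∉ φ.invFun '' Q := by
      rintro ⟨z, hz, rfl⟩
      exact hp (inv_mem (hQt hz))
    refine (continuousAt_const (y := (0 : ℝ))).congr ?_
    filter_upwards [hQc.isOpen_compl.mem_nhds hpQ] with q hq
    exact (hz q hq).symm

variable [MeasurableSpace S] [BorelSpace S]

lemma restrict_leafVol_plaque (hφ : 𝓢.IsFlowBox φ) {y : Eu l} (hy : y ∈ φ.transv) {L : Set S}
    (h : φ.plaque y ⊆ L) : (G.leafVol L).restrict (φ.plaque y) = G.plaqueVol φ y := by
  ext A hA
  rw [Measure.restrict_apply hA, leafVol_eq G hφ hy h (hA.inter (measurableSet_plaque hy))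
    Set.inter_subset_right, plaqueVol_inter_plaque G hy hA]

/-- Full disks in `C` are disjoint sets of positive volume inside a set of finite volume.
Countability lets the integral over their union be summed disk by disk. -/
lemma countable_full_plaques (hφ : 𝓢.IsFlowBox φ) {L C : Set S} (hCL : C ⊆ L)
    (hfin : G.leafVol L C < ⊤) : {y | y ∈ φ.transv ∧ φ.plaque y ⊆ C}.Countable := by
  set Y := {y | y ∈ φ.transv ∧ φ.plaque y ⊆ C}
  have : IsFiniteMeasure ((G.leafVol L).restrict C) := ⟨by rwa [Measure.restrict_apply_univ]⟩
  have h := Measure.countable_meas_pos_of_disjoint_iUnion (μ := (G.leafVol L).restrict C)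
    (As := fun y : Y => φ.plaque y) (fun y => measurableSet_plaque y.2.1)
    (fun y z hyz => disjoint_plaque y.2.1 z.2.1 fun h => hyz (Subtype.ext h))
  have h2 : {y : Y | 0 < ((G.leafVol L).restrict C) (φ.plaque y)} = Set.univ := by
    refine Set.eq_univ_of_forall fun y => ?_
    rw [Set.mem_ofPred_eq, Measure.restrict_apply (measurableSet_plaque y.2.1),
      Set.inter_eq_left.2 y.2.2, leafVol_eq G hφ y.2.1 (y.2.2.trans hCL)
      (measurableSet_plaque y.2.1) subset_rfl]
    exact plaqueVol_plaque_pos G hφ y.2.1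
  rw [h2] at h
  exact Set.countable_coe_iff.1 (Set.countable_univ_iff.1 h)

/-- A continuous function with zero mean on all local leaves of a flow-box and which vanishes
outside it only sees the partial local leaves. -/
lemma setIntegral_leafVol_eq (hφ : 𝓢.IsFlowBox φ) {L C : Set S} (hC : MeasurableSet C)
    (hCL : C ⊆ L) (hfin : G.leafVol L C < ⊤) {f : S → ℝ} (hf : Continuous f) {c : ℝ}
    (hfc : ∀ p, |f p| ≤ c) (hfU : ∀ p ∉ φ.source, f p = 0)
    (hf0 : ∀ y ∈ φ.transv, ∫ p, f p ∂(G.plaqueVol φ y) = 0) :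
    ∫ p in C, f p ∂(G.leafVol L) = ∫ p in partialPart φ C, f p ∂(G.leafVol L) := by
  set Y := {y | y ∈ φ.transv ∧ φ.plaque y ⊆ C} with hY
  have hYc : Countable Y := (countable_full_plaques G hφ hCL hfin).to_subtype
  have hfull : fullPart φ C = ⋃ y : Y, φ.plaque y := by
    unfold fullPart; rw [Set.biUnion_eq_iUnion]
  have hfm : MeasurableSet (fullPart φ C) := by
    rw [hfull]; exact MeasurableSet.iUnion fun y => measurableSet_plaque y.2.1
  have hint : ∀ s ⊆ C, IntegrableOn f s (G.leafVol L) := fun s hs =>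
    IntegrableOn.of_bound ((measure_mono hs).trans_lt hfin) hf.aestronglyMeasurable c
      (Eventually.of_forall hfc)
  have h0 : ∫ p in fullPart φ C, f p ∂(G.leafVol L) = 0 := by
    have hs := fullPart_subset (φ := φ) (C := C)
    rw [hfull] at hs ⊢
    rw [integral_iUnion (fun y : Y => measurableSet_plaque y.2.1)
      (fun y z hyz => disjoint_plaque y.2.1 z.2.1 fun h => hyz (Subtype.ext h))
      (hint _ (hs.trans Set.inter_subset_left))]
    convert tsum_zero with y
    rw [restrict_leafVol_plaque G hφ y.2.1 (y.2.2.trans hCL), hf0 _ y.2.1]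
  have h1 : ∫ p in C ∩ φ.source, f p ∂(G.leafVol L) = ∫ p in C, f p ∂(G.leafVol L) :=
    (setIntegral_eq_of_subset_of_forall_sdiff_eq_zero hC Set.inter_subset_left
      fun p hp => hfU p fun h => hp.2 ⟨hp.1, h⟩).symm
  rw [← h1, ← integral_inter_add_sdiff hfm (hint _ Set.inter_subset_left),
    Set.inter_eq_right.2 fullPart_subset, h0, zero_add]
  rfl

/-- Only the partial disks contribute, and the normalizing volume of `C` is at least that of its
full part. The ratio has to be finite since `toReal` sends `∞` to `0`. -/
lemma abs_integral_normalizedVol_le (hφ : 𝓢.IsFlowBox φ) {L C : Set S} (hC : MeasurableSet C)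
    (hCL : C ⊆ L) (hfin : G.leafVol L C < ⊤) {f : S → ℝ} (hf : Continuous f) {c : ℝ}
    (hfc : ∀ p, |f p| ≤ c) (hfU : ∀ p ∉ φ.source, f p = 0)
    (hf0 : ∀ y ∈ φ.transv, ∫ p, f p ∂(G.plaqueVol φ y) = 0)
    (hr : G.leafVol L (partialPart φ C) / G.leafVol L (fullPart φ C) ≠ ⊤) :
    |∫ p, f p ∂(G.normalizedVol L C)| ≤
      c * (G.leafVol L (partialPart φ C) / G.leafVol L (fullPart φ C)).toReal := by
  have hp : partialPart φ C ⊆ C := fun p hp => hp.1.1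
  have hpf : G.leafVol L (partialPart φ C) < ⊤ := (measure_mono hp).trans_lt hfin
  have hb := norm_setIntegral_le_of_norm_le_const (μ := G.leafVol L) (s := partialPart φ C)
    (f := f) (C := c) hpf (fun p _ => hfc p)
  unfold normalizedVol
  rw [integral_smul_measure, setIntegral_leafVol_eq G hφ hC hCL hfin hf hfc hfU hf0, smul_eq_mul,
    abs_mul, abs_of_nonneg ENNReal.toReal_nonneg]
  refine (mul_le_mul_of_nonneg_left hb ENNReal.toReal_nonneg).trans ?_
  rw [mul_left_comm, measureReal_def, ← ENNReal.toReal_mul]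
  -- The sign of `c` is known only through `|f p| ≤ c` at some point `p`, so the empty space is
  -- treated apart.
  have hSn : Nonempty S ∨ IsEmpty S := (isEmpty_or_nonempty S).symm
  rcases hSn with ⟨⟨p⟩⟩ | hS
  · refine mul_le_mul_of_nonneg_left (ENNReal.toReal_mono hr ?_) ((abs_nonneg _).trans (hfc p))
    rw [mul_comm, ← div_eq_mul_inv]
    exact ENNReal.div_le_div_left (measure_mono (fullPart_subset.trans Set.inter_subset_left)) _
  · simp [Set.eq_empty_of_isEmpty]

/-- In the limit, continuous functions with zero mean on the local leaves of a flow-box with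
controlled growth have zero integral. -/
lemma integral_eq_zero_of_limit (hφ : 𝓢.IsFlowBox φ) {L : Set S} {C : ℕ → Set S}
    (hL : 𝓢.IsLeaf L) (hC : 𝓢.IsExhaustion L C)
    (hg : Tendsto (fun n => G.leafVol L (partialPart φ (C n)) / G.leafVol L (fullPart φ (C n)))
      atTop (𝓝 0)) {𝓕 : Filter ℕ} [𝓕.NeBot] (h𝓕 : 𝓕 ≤ atTop) {μ : Measure S} {f : S → ℝ}
    (hμ : Tendsto (fun n => ∫ p, f p ∂(G.normalizedVol L (C n))) 𝓕 (𝓝 (∫ p, f p ∂μ)))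
    (hf : Continuous f) {c : ℝ} (hfc : ∀ p, |f p| ≤ c) (hfU : ∀ p ∉ φ.source, f p = 0)
    (hf0 : ∀ y ∈ φ.transv, ∫ p, f p ∂(G.plaqueVol φ y) = 0) : ∫ p, f p ∂μ = 0 := by
  have hg' := hg.mono_left h𝓕
  refine tendsto_nhds_unique hμ (squeeze_zero_norm' (a := fun n => c *
    (G.leafVol L (partialPart φ (C n)) / G.leafVol L (fullPart φ (C n))).toReal) ?_ ?_)
  · filter_upwards [hg'.eventually (gt_mem_nhds ENNReal.zero_lt_top)] with n hn
    have hCL : C n ⊆ L := by rw [← hC.iUnion_eq]; exact Set.subset_iUnion C n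
    exact abs_integral_normalizedVol_le G hφ (hC.measurableSet n) hCL
      (leafVol_exhaustion_lt_top G hL hC n) hf hfc hfU hf0 hn.ne
  · have := ((ENNReal.tendsto_toReal ENNReal.zero_ne_top).comp hg').const_mul c
    simpa using this

/-- The inverse density in `f` cancels the density of the volume, leaving `b y * ∫ a`. -/
lemma integral_plaqueVol_test (hφ : 𝓢.IsFlowBox φ) {y : Eu l} (hy : y ∈ φ.transv)
    {a : Eu k → ℝ} {b : Eu l → ℝ} (ha0 : ∀ x ∉ Metric.ball (0 : Eu k) 1, a x = 0)
    (ha : ∫ x, a x = 0) {f : S → ℝ} (hf : Continuous f)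
    (hfF : ∀ p ∈ φ.source,
      f p = (G.density φ (φ.toFun p))⁻¹ * (a (φ.toFun p).1 * b (φ.toFun p).2)) :
    ∫ p, f p ∂(G.plaqueVol φ y) = 0 := by
  unfold plaqueVol
  have h := (continuousOn_inv_mk hy).aemeasurable (μ := volume) Metric.isOpen_ball.measurableSet
  have hm : AEMeasurable (fun x => ENNReal.ofReal (G.density φ (x, y)))
      (volume.restrict (Metric.ball (0 : Eu k) 1)) :=
    ((density_continuousOn G hφ).comp (Continuous.prodMk_left y).continuousOn
      fun x hx => mk_mem_target hx hy).aemeasurable Metric.isOpen_ball.measurableSet |>.ennreal_ofReal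
  rw [integral_map (h.mono_ac (withDensity_absolutelyContinuous _ _)) hf.aestronglyMeasurable,
    integral_withDensity_eq_integral_toReal_smul₀ hm
    (Eventually.of_forall fun _ => ENNReal.ofReal_lt_top),
    setIntegral_congr_fun (g := fun x => a x * b y) Metric.isOpen_ball.measurableSet,
    integral_mul_const, setIntegral_eq_integral_of_forall_compl_eq_zero ha0, ha, zero_mul]
  intro x hx
  have ht := mk_mem_target (φ := φ) hx hy
  have hpos := density_pos G hφ ht
  simp only [smul_eq_mul]
  rw [hfF _ (inv_mem ht), toFun_inv ht, ENNReal.toReal_ofReal hpos.le, ← mul_assoc,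
    mul_inv_cancel₀ hpos.ne', one_mul]

variable [CompactSpace S] [T2Space S]

lemma integral_flatten (hφ : 𝓢.IsFlowBox φ) {μ : Measure S} {F : Eu k × Eu l → ℝ}
    (hF : Measurable F) {f : S → ℝ} (hfU : ∀ p ∉ φ.source, f p = 0)
    (hfF : ∀ p ∈ φ.source, f p = (G.density φ (φ.toFun p))⁻¹ * F (φ.toFun p)) :
    ∫ z, F z ∂(G.flatten φ μ) = ∫ p, f p ∂μ := by
  have hm : Measurable fun z => (G.extDensity φ z)⁻¹ := (measurable_extDensity G hφ).inv
  have ht : ∀ᵐ z ∂(chartMeasure φ μ), z ∈ φ.target := by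
    rw [ae_iff]; exact chartMeasure_compl (φ := φ)
  unfold flatten
  rw [integral_withDensity_eq_integral_toReal_smul hm
    (ht.mono fun z hz => (ENNReal.inv_lt_top.2 (pos_iff_ne_zero.2 (extDensity_ne_zero G hφ hz))))]
  unfold chartMeasure
  have hmF : Measurable fun z => (G.extDensity φ z)⁻¹.toReal • F z := hm.ennreal_toReal.smul hF
  rw [integral_map aemeasurable_toFun hmF.aestronglyMeasurable,
    ← setIntegral_eq_integral_of_forall_compl_eq_zero (s := φ.source) fun p hp => hfU p hp]
  refine setIntegral_congr_fun measurableSet_source fun p hp => ?_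
  simp only [smul_eq_mul]
  rw [hfF p hp, extDensity_of_mem G (toFun_mem hp), ENNReal.toReal_inv,
    ENNReal.toReal_ofReal (density_pos G hφ (toFun_mem hp)).le]

/-- The limits of the normalized volumes are locally products in the flow-boxes with controlled
growth. -/
lemma exists_const_of_limit (hφ : 𝓢.IsFlowBox φ) {L : Set S} {C : ℕ → Set S}
    (hL : 𝓢.IsLeaf L) (hC : 𝓢.IsExhaustion L C)
    (hg : Tendsto (fun n => G.leafVol L (partialPart φ (C n)) / G.leafVol L (fullPart φ (C n)))
      atTop (𝓝 0)) {𝓕 : Filter ℕ} [𝓕.NeBot] (h𝓕 : 𝓕 ≤ atTop) {μ : Measure S} [IsFiniteMeasure μ]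
    (hμ : ∀ f : C(S, ℝ), Tendsto (fun n => ∫ p, f p ∂(G.normalizedVol L (C n))) 𝓕
      (𝓝 (∫ p, f p ∂μ))) :
    ∀ x ∈ Metric.ball (0 : Eu k) 1, ∀ y ∈ φ.transv, ∃ V ∈ 𝓝 x, ∃ N ∈ 𝓝 y, ∀ B ⊆ N,
      B ⊆ φ.transv → MeasurableSet B →
      ∃ c : ENNReal, ∀ A ⊆ V, MeasurableSet A → G.flatten φ μ (A ×ˢ B) = c * volume A := by
  intro x hx y hy
  obtain ⟨r₁, hr₁, hD₁, hK₁⟩ := exists_compact_box hx hy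
  obtain ⟨W, hW, hWf⟩ := flatten_locally_finite G (μ := μ) hφ (mk_mem_target hx hy)
  obtain ⟨r₂, hr₂, hW₂⟩ := Metric.nhds_basis_closedBall.mem_iff.1 hW
  -- The first radius gives a compact box in the target, as `exists_test_function` requires; the
  -- second gives finite mass.
  set r := min r₁ r₂ with hr
  have hrpos : 0 < r := lt_min hr₁ hr₂
  have hxr : Metric.closedBall x r ⊆ Metric.ball 0 1 :=
    (Metric.closedBall_subset_closedBall (min_le_left _ _)).trans hD₁
  have hyr : IsCompact (Metric.closedBall y r ∩ φ.transv) := by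
    have : Metric.closedBall y r ∩ φ.transv =
        (Metric.closedBall y r₁ ∩ φ.transv) ∩ Metric.closedBall y r := by
      ext z
      have h := Metric.closedBall_subset_closedBall (x := y) (min_le_left r₁ r₂)
      constructor
      · exact fun hz => ⟨⟨h hz.1, hz.2⟩, hz.1⟩
      · exact fun hz => ⟨hz.2, hz.1.2⟩
    rw [this]
    exact hK₁.inter_right Metric.isClosed_closedBall
  refine ⟨_, Metric.ball_mem_nhds x (half_pos hrpos), _, Metric.ball_mem_nhds y (half_pos hrpos),
    fun B hB _ hBm => exists_const_of_integral_eq_zero hrpos ?_ ?_ hB hBm⟩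
  · refine (measure_mono ?_).trans_lt hWf
    rw [closedBall_prod_same]
    exact (Metric.closedBall_subset_closedBall (min_le_right _ _)).trans hW₂
  · intro a b ha hb ha0 hb0 hint
    obtain ⟨f, hfc, hfU, hfF⟩ := exists_test_function G hφ hxr hyr ha hb ha0 hb0
    rw [integral_flatten G hφ (by fun_prop) hfU hfF]
    exact integral_eq_zero_of_limit G hφ hL hC hg h𝓕 (hμ ⟨f, hfc⟩) hfc
      (c := ‖(⟨f, hfc⟩ : C(S, ℝ))‖) (fun p => (⟨f, hfc⟩ : C(S, ℝ)).norm_coe_le_norm p) hfU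
      fun y hy => integral_plaqueVol_test G hφ hy (fun x hx => ha0 x fun h => hx (hxr h)) hint hfc hfF

end Solenoid.RiemannianMetric

/-! ### From a covering to all flow-boxes; correspondence of transverse measures. -/

namespace Solenoid.RiemannianMetric

variable {k l : ℕ} {S : Type*} [TopologicalSpace S] {𝓢 : Solenoid k l S}
  {φ ψ : FlowBox k l S} (G : 𝓢.RiemannianMetric) [MeasurableSpace S] [BorelSpace S]
  [CompactSpace S] [T2Space S] {μ : Measure S}

/-- Local disintegrations can be transferred from one flow-box to another. -/
lemma exists_transfer (hφ : 𝓢.IsFlowBox φ) (hψ : 𝓢.IsFlowBox ψ) {p : S} (h₁ : p ∈ φ.source)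
    (h₂ : p ∈ ψ.source) : ∃ W ∈ 𝓝 p, W ⊆ φ.source ∩ ψ.source ∧
      ∃ (N : Set (Eu l)) (Z : Eu l → Eu l), MeasurableSet N ∧
      (∀ q ∈ W, (φ.toFun q).2 ∈ N ∩ φ.transv ∧ (ψ.toFun q).2 = Z (φ.toFun q).2) ∧
      ContinuousOn Z (N ∩ φ.transv) ∧ Set.MapsTo Z (N ∩ φ.transv) ψ.transv ∧
      ∀ (μ : Measure S) (ν : Measure (Eu l)), ν φ.transvᶜ = 0 → G.DisintegratesOn φ μ ν W →
        G.DisintegratesOn ψ μ ((ν.restrict (N ∩ φ.transv)).map Z) W := by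
  obtain ⟨Y, hY⟩ := hφ.transverse hψ h₁ h₂
  -- The reverse transverse map makes `Z` injective on the relevant set, so within `W` a local leaf
  -- of `ψ` does not meet two local leaves of `φ`.
  obtain ⟨Y', hY'⟩ := hψ.transverse hφ h₂ h₁
  obtain ⟨r, hr, hrD, hrW⟩ := exists_box_subset h₁
    (inter_mem (ψ.open_source.mem_nhds h₂) (inter_mem hY hY'))
  set x₀ := (φ.toFun p).1
  set y₀ := (φ.toFun p).2
  set N := Metric.ball y₀ r with hN
  set W := φ.box (Metric.ball x₀ r) N with hW
  have hs : ∀ y ∈ N ∩ φ.transv, φ.invFun (x₀, y) ∈ W ∧ (φ.toFun (φ.invFun (x₀, y))).2 = y := by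
    intro y hy
    have ht := mk_mem_target (φ := φ) (hrD (Metric.mem_ball_self hr)) hy.2
    refine ⟨⟨inv_mem ht, ?_⟩, by rw [toFun_inv ht]⟩
    rw [Set.mem_preimage, toFun_inv ht]
    exact ⟨Metric.mem_ball_self hr, hy.1⟩
  -- `Y` is an arbitrary function with no stated regularity. Reading the transverse coordinate of
  -- `ψ` on the vertical slice through `x₀` gives a continuous map with the same values.
  set Z : Eu l → Eu l := fun y => (ψ.toFun (φ.invFun (x₀, y))).2 with hZ
  have hNK : MeasurableSet (N ∩ φ.transv) := Metric.isOpen_ball.measurableSet.inter measurableSet_transv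
  have hZc : ContinuousOn Z (N ∩ φ.transv) :=
    continuous_snd.comp_continuousOn (ψ.continuousOn_toFun.comp
      (φ.continuousOn_invFun.comp (Continuous.prodMk_right x₀).continuousOn
        fun y hy => mk_mem_target (hrD (Metric.mem_ball_self hr)) hy.2)
      fun y hy => (hrW (hs y hy).1).1)
  have hZm : Set.MapsTo Z (N ∩ φ.transv) ψ.transv := fun y hy => snd_mem (hrW (hs y hy).1).1
  have hyN : ∀ q ∈ W, (φ.toFun q).2 ∈ N ∩ φ.transv := fun q hq => ⟨hq.2.2, snd_mem hq.1⟩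
  have hZq : ∀ q ∈ W, (ψ.toFun q).2 = Z (φ.toFun q).2 := by
    intro q hq
    obtain ⟨h3, h4⟩ := hs _ (hyN q hq)
    have h5 : (ψ.toFun q).2 = Y (φ.toFun q).2 := (hrW hq).2.1
    have h6 : Z (φ.toFun q).2 = Y (φ.toFun (φ.invFun (x₀, (φ.toFun q).2))).2 := (hrW h3).2.1
    rw [h5, h6, h4]
  refine ⟨W, box_mem_nhds h₁ (Metric.ball_mem_nhds _ hr) (Metric.ball_mem_nhds _ hr),
    fun q hq => ⟨hq.1, (hrW hq).1⟩, N, Z, Metric.isOpen_ball.measurableSet,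
    fun q hq => ⟨hyN q hq, hZq q hq⟩, hZc, hZm, fun μ ν hν hμ A hA hAW => ?_⟩
  obtain ⟨F, hF, hFA⟩ := exists_measurable_plaqueVol G hψ hA
  have hZae : AEMeasurable Z (ν.restrict (N ∩ φ.transv)) := hZc.aemeasurable hNK
  have hZK : ∀ᵐ z ∂((ν.restrict (N ∩ φ.transv)).map Z), z ∈ ψ.transv := by
    refine (ae_map_iff hZae ψ.measurableSet_transv).2 ((ae_restrict_iff' hNK).2 ?_)
    exact Eventually.of_forall fun y hy => hZm hy
  rw [hμ A hA hAW, lintegral_congr_ae (hZK.mono fun z hz => hFA z hz),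
    lintegral_map' hF.aemeasurable hZae, ← lintegral_indicator hNK]
  refine lintegral_congr_ae ((ae_mem_of_compl hν).mono fun y hyK => ?_)
  by_cases hyN' : y ∈ N
  · have hy : y ∈ N ∩ φ.transv := ⟨hyN', hyK⟩
    have hsets : A ∩ φ.plaque y = A ∩ ψ.plaque (Z y) := by
      ext q
      simp only [Set.mem_inter_iff, mem_plaque hy.2, mem_plaque (hZm hy)]
      constructor
      · rintro ⟨hqA, hq, rfl⟩
        exact ⟨hqA, (hrW (hAW hqA)).1, hZq q (hAW hqA)⟩
      · rintro ⟨hqA, hq, hqZ⟩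
        refine ⟨hqA, (hAW hqA).1, ?_⟩
        have h5 : (φ.toFun q).2 = Y' (ψ.toFun q).2 := (hrW (hAW hqA)).2.2
        have h6 : (φ.toFun (φ.invFun (x₀, y))).2 = Y' (Z y) := (hrW (hs y hy).1).2.2
        rw [h5, hqZ, ← h6, (hs y hy).2]
    beta_reduce
    rw [Set.indicator_of_mem hy, ← hFA _ (hZm hy), ← plaqueVol_inter_plaque G hy.2 hA,
      ← plaqueVol_inter_plaque G (hZm hy) hA, ← hsets]
    refine plaqueVol_eq G hφ hψ hy.2 (hZm hy) (hA.inter (measurableSet_plaque hy.2))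
      Set.inter_subset_right ?_
    rw [hsets]
    exact Set.inter_subset_right
  · rw [Set.indicator_of_notMem fun h => hyN' h.1]
    refine plaqueVol_eq_zero G hyK hA (Set.disjoint_left.2 fun q hq hqy => hyN' ?_)
    rw [← ((mem_plaque hyK).1 hqy).2]
    exact (hyN q (hAW hq)).1

lemma transMeasure_compl : G.transMeasure φ μ φ.transvᶜ = 0 := by
  refine transverseFactor_compl φ.measurableSet_transv ?_
  rw [← φ.target_eq]
  exact flatten_compl G

/-- In the flow-box `φ`, the measure `μ` is the product of the volume along the leaves and of a
measure on the transversal. -/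
def IsProductIn (φ : FlowBox k l S) (μ : Measure S) : Prop :=
  G.flatten φ μ = (volume.restrict (Metric.ball (0 : Eu k) 1)).prod (G.transMeasure φ μ)

lemma IsProductIn.disintegratesOn [IsFiniteMeasure μ] (h : G.IsProductIn φ μ)
    (hφ : 𝓢.IsFlowBox φ) : G.DisintegratesOn φ μ (G.transMeasure φ μ) φ.source :=
  disintegratesOn_of_flatten G hφ (transMeasure_compl G) h

lemma isProductIn_of_locally [IsFiniteMeasure μ] (hφ : 𝓢.IsFlowBox φ)
    (h : ∀ x ∈ Metric.ball (0 : Eu k) 1, ∀ y ∈ φ.transv, ∃ V ∈ 𝓝 x, ∃ N ∈ 𝓝 y, ∀ B ⊆ N,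
      B ⊆ φ.transv → MeasurableSet B →
      ∃ c : ENNReal, ∀ A ⊆ V, MeasurableSet A → G.flatten φ μ (A ×ˢ B) = c * volume A) :
    G.IsProductIn φ μ := by
  refine eq_prod_of_locally φ.measurableSet_transv (fun y hy => ?_) ?_ (fun z hz => ?_) h
  · obtain ⟨r, hr, -, hc⟩ := exists_compact_box (φ := φ) (x := 0) (by simp) hy
    exact ⟨r, hr, hc⟩
  · rw [← φ.target_eq]
    exact flatten_compl G
  · rw [← φ.target_eq] at hz
    exact flatten_locally_finite G hφ hz

/-- A measure which disintegrates in the flow-boxes of a covering disintegrates in all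
flow-boxes. -/
lemma isProductIn_of_cover [IsFiniteMeasure μ]
    (h : ∀ p, ∃ φ, 𝓢.IsFlowBox φ ∧ p ∈ φ.source ∧ G.IsProductIn φ μ) (hψ : 𝓢.IsFlowBox ψ) :
    G.IsProductIn ψ μ := by
  refine isProductIn_of_locally G hψ fun x hx y hy => ?_
  have ht := mk_mem_target hx hy
  have hp := inv_mem ht
  have hpt := toFun_inv ht
  set p := ψ.invFun (x, y)
  obtain ⟨φ, hφ, hpφ, hφμ⟩ := h p
  obtain ⟨W, hW, hWs, N, Z, hNm, hN, hZc, hZm, htr⟩ := exists_transfer G hφ hψ hpφ hp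
  have hd := htr μ _ (transMeasure_compl G)
    ((hφμ.disintegratesOn G hφ).mono G fun q hq => (hWs hq).1)
  set ν := ((G.transMeasure φ μ).restrict (N ∩ φ.transv)).map Z
  have hν : ν ψ.transvᶜ = 0 := by
    have hNK := hNm.inter φ.measurableSet_transv
    have := (ae_map_iff (p := fun z => z ∈ ψ.transv) (hZc.aemeasurable hNK)
      ψ.measurableSet_transv).2 ((ae_restrict_iff' (μ := G.transMeasure φ μ) hNK).2
        (Eventually.of_forall fun y hy => hZm hy))
    rwa [ae_iff] at this
  obtain ⟨r, hr, hrD, hrW⟩ := exists_box_subset hp hW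
  rw [hpt] at hrD hrW
  have key := flatten_restrict_eq G hψ hν Metric.isOpen_ball.measurableSet
    Metric.isOpen_ball.measurableSet (hd.mono G hrW)
  -- The transferred transverse measure `ν` supplies the constant `ν B`.
  refine ⟨_, Metric.ball_mem_nhds x hr, _, Metric.ball_mem_nhds y hr, fun B hB _ hBm =>
    ⟨ν B, fun A hA hAm => ?_⟩⟩
  have := congrArg (fun m => m (A ×ˢ B)) key
  simp only [Measure.restrict_apply (hAm.prod hBm)] at this
  rw [Set.inter_eq_left.2 (Set.prod_mono hA hB), Measure.prod_prod, Measure.restrict_apply hAm,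
    Set.inter_eq_left.2 (hA.trans hrD)] at this
  rw [this, mul_comm]

/-- The transverse measure of a local disintegration is unique. -/
lemma transverse_unique [IsFiniteMeasure μ] (hφ : 𝓢.IsFlowBox φ) {ν ν' : Measure (Eu l)}
    [SFinite ν] [SFinite ν'] (hν : ν φ.transvᶜ = 0) (hν' : ν' φ.transvᶜ = 0) {p : S}
    (hp : p ∈ φ.source) {W : Set S} (hW : W ∈ 𝓝 p) (h : G.DisintegratesOn φ μ ν W)
    (h' : G.DisintegratesOn φ μ ν' W) :
    ∃ N ∈ 𝓝 (φ.toFun p).2, ν.restrict N = ν'.restrict N := by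
  obtain ⟨r, hr, hrD, hrW⟩ := exists_box_subset hp hW
  refine ⟨_, Metric.ball_mem_nhds _ hr, ?_⟩
  have hm := Metric.isOpen_ball (x := (φ.toFun p).1) (ε := r)
  have key := (flatten_restrict_eq G hφ hν hm.measurableSet
    (Metric.isOpen_ball (x := (φ.toFun p).2) (ε := r)).measurableSet (h.mono G hrW)).symm.trans
    (flatten_restrict_eq G hφ hν' hm.measurableSet Metric.isOpen_ball.measurableSet (h'.mono G hrW))
  ext B hB
  have := congrArg (fun m => m (Metric.ball (φ.toFun p).1 r ×ˢ B)) key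
  simp only [Measure.restrict_apply (hm.measurableSet.prod hB), Set.prod_inter_prod,
    Measure.prod_prod, Set.inter_self, Measure.restrict_apply hm.measurableSet,
    Set.inter_eq_left.2 hrD] at this
  rw [Measure.restrict_apply hB, Measure.restrict_apply hB]
  exact (ENNReal.mul_right_inj (Metric.measure_ball_pos volume _ hr).ne' measure_ball_lt_top.ne).1 this

/-- Transferring the disintegration from `φ` to `ψ` and uniqueness of the transverse measure
identify that of `ψ` with a pushforward. As `E` need not be measurable, `Measure.le_map_apply` gives
only an inequality; exchanging `φ` and `ψ` gives the other one. -/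
lemma transMeasure_le [IsFiniteMeasure μ] (hφ : 𝓢.IsFlowBox φ) (hψ : 𝓢.IsFlowBox ψ)
    (h₁ : G.IsProductIn φ μ) (h₂ : G.IsProductIn ψ μ) {p : S} (hpφ : p ∈ φ.source)
    (hpψ : p ∈ ψ.source) : ∃ W ∈ 𝓝 p, ∀ E ⊆ W,
      G.transMeasure φ μ ((fun q => (φ.toFun q).2) '' E) ≤
        G.transMeasure ψ μ ((fun q => (ψ.toFun q).2) '' E) := by
  obtain ⟨W, hW, hWs, N, Z, hNm, hN, hZc, hZm, htr⟩ := exists_transfer G hφ hψ hpφ hpψ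
  have hd := htr μ _ (transMeasure_compl G)
    ((h₁.disintegratesOn G hφ).mono G fun q hq => (hWs hq).1)
  have hNK := hNm.inter φ.measurableSet_transv
  have hZae : AEMeasurable Z ((G.transMeasure φ μ).restrict (N ∩ φ.transv)) := hZc.aemeasurable hNK
  set ν := ((G.transMeasure φ μ).restrict (N ∩ φ.transv)).map Z with hνdef
  have hν : ν ψ.transvᶜ = 0 := by
    have := (ae_map_iff (p := fun z => z ∈ ψ.transv) hZae
      ψ.measurableSet_transv).2 ((ae_restrict_iff' (μ := G.transMeasure φ μ) hNK).2
        (Eventually.of_forall fun y hy => hZm hy))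
    rwa [ae_iff] at this
  obtain ⟨N', hN', he⟩ := transverse_unique G hψ hν (transMeasure_compl G) hpψ hW hd
    ((h₂.disintegratesOn G hψ).mono G fun q hq => (hWs hq).2)
  refine ⟨W ∩ (ψ.source ∩ ψ.toFun ⁻¹' (Set.univ ×ˢ N')),
    inter_mem hW (box_mem_nhds hpψ univ_mem hN'), fun E hE => ?_⟩
  have hEN : (fun q => (ψ.toFun q).2) '' E ⊆ N' := by
    rintro _ ⟨q, hq, rfl⟩
    exact (hE hq).2.2.2
  rw [← Measure.restrict_eq_self _ hEN, ← he, Measure.restrict_eq_self _ hEN]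
  refine le_trans ?_ (le_of_le_of_eq (Measure.le_map_apply hZae _) rfl)
  rw [Measure.restrict_apply' hNK]
  refine measure_mono ?_
  rintro _ ⟨q, hq, rfl⟩
  exact ⟨⟨q, hq, (hN q (hE hq).1).2⟩, (hN q (hE hq).1).1⟩

/-- The transverse measures of two flow-boxes correspond under the change of charts. -/
lemma transMeasure_eq [IsFiniteMeasure μ] (hφ : 𝓢.IsFlowBox φ) (hψ : 𝓢.IsFlowBox ψ)
    (h₁ : G.IsProductIn φ μ) (h₂ : G.IsProductIn ψ μ) {p : S} (hpφ : p ∈ φ.source)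
    (hpψ : p ∈ ψ.source) : ∃ W ∈ 𝓝 p, ∀ E ⊆ W,
      G.transMeasure φ μ ((fun q => (φ.toFun q).2) '' E) =
        G.transMeasure ψ μ ((fun q => (ψ.toFun q).2) '' E) := by
  obtain ⟨W₁, hW₁, h3⟩ := transMeasure_le G hφ hψ h₁ h₂ hpφ hpψ
  obtain ⟨W₂, hW₂, h4⟩ := transMeasure_le G hψ hφ h₂ h₁ hpψ hpφ
  exact ⟨W₁ ∩ W₂, inter_mem hW₁ hW₂, fun E hE =>
    le_antisymm (h3 E fun q hq => (hE hq).1) (h4 E fun q hq => (hE hq).2)⟩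

end Solenoid.RiemannianMetric

/-! ### Holonomy invariance and the induced transversal measure. -/

lemma unitInterval.exists_preconnected_nhds {s : unitInterval} {J : Set unitInterval}
    (hJ : J ∈ 𝓝 s) : ∃ J' ∈ 𝓝 s, J' ⊆ J ∧ IsPreconnected J' := by
  obtain ⟨ε, hε, h⟩ := Metric.mem_nhds_iff.1 hJ
  refine ⟨_, Metric.ball_mem_nhds s hε, h, ?_⟩
  rw [← Topology.IsInducing.subtypeVal.isPreconnected_image]
  have : Subtype.val '' Metric.ball s ε = unitInterval ∩ Metric.ball (s : ℝ) ε := by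
    ext x
    constructor
    · rintro ⟨y, hy, rfl⟩
      exact ⟨y.2, hy⟩
    · rintro ⟨h1, h2⟩
      exact ⟨⟨x, h1⟩, h2, rfl⟩
  rw [this]
  exact ((convex_Icc 0 1).inter (convex_ball _ _)).isPreconnected

namespace Solenoid

variable {k l : ℕ} {S : Type*} [TopologicalSpace S] {𝓢 : Solenoid k l S} {φ ψ : FlowBox k l S}

/-- A path in a leaf stays in the same local leaf as long as it stays in a flow-box. -/
lemma IsFlowBox.snd_eq_of_path (hφ : 𝓢.IsFlowBox φ) {γ : unitInterval → S}
    (hγ : @Continuous unitInterval S inferInstance 𝓢.leafTopology γ) {J : Set unitInterval}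
    (hJ : IsPreconnected J) (hJφ : ∀ s ∈ J, γ s ∈ φ.source) {s s' : unitInterval} (hs : s ∈ J)
    (hs' : s' ∈ J) : (φ.toFun (γ s)).2 = (φ.toFun (γ s')).2 := by
  refine hJ.induction₂ (fun s s' => (φ.toFun (γ s)).2 = (φ.toFun (γ s')).2) (fun s hs => ?_)
    (fun _ _ _ _ _ _ h h' => h.trans h') (fun _ _ _ _ h => h.symm) hs hs'
  have hy := snd_mem (hJφ s hs)
  have ho : IsOpen (γ ⁻¹' φ.plaque (φ.toFun (γ s)).2) :=
    (@continuous_def _ _ _ 𝓢.leafTopology _).1 hγ _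
      (RiemannianMetric.isOpen_leafTopology_plaque hφ hy)
  refine mem_nhdsWithin_of_mem_nhds (Filter.mem_of_superset
    (ho.mem_nhds ((mem_plaque hy).2 ⟨hJφ s hs, rfl⟩)) fun s' h => ?_)
  exact ((mem_plaque hy).1 h).2.symm

namespace RiemannianMetric

variable (G : 𝓢.RiemannianMetric) [MeasurableSpace S] [BorelSpace S]
  [CompactSpace S] [T2Space S] {μ : Measure S}

/-- Holonomy preserves the transverse measures, locally. -/
lemma transMeasure_holonomy [IsFiniteMeasure μ] (hμ : ∀ φ, 𝓢.IsFlowBox φ → G.IsProductIn φ μ)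
    (hφ : 𝓢.IsFlowBox φ) (hψ : 𝓢.IsFlowBox ψ) {X : Set S} {H : S × unitInterval → S}
    (hH : ContinuousOn H (X ×ˢ Set.univ))
    (hleaf : ∀ t ∈ X, @Continuous unitInterval S inferInstance 𝓢.leafTopology (fun s => H (t, s)))
    {t₀ : S} (ht₀ : t₀ ∈ X) (h₀ : H (t₀, 0) ∈ φ.source) (h₁ : H (t₀, 1) ∈ ψ.source) :
    ∃ O ∈ 𝓝 t₀, ∀ E ⊆ O ∩ X,
      G.transMeasure φ μ ((fun t => (φ.toFun (H (t, 0))).2) '' E) =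
        G.transMeasure ψ μ ((fun t => (ψ.toFun (H (t, 1))).2) '' E) := by
  set m : FlowBox k l S → unitInterval → Set S → ENNReal := fun χ s E =>
    G.transMeasure χ μ ((fun t => (χ.toFun (H (t, s))).2) '' E) with hm
  -- Continuation along the path: `P` holds at `0`, its truth value is locally constant, and the
  -- unit interval is connected.
  set P : unitInterval → Prop := fun s => ∃ χ, 𝓢.IsFlowBox χ ∧ H (t₀, s) ∈ χ.source ∧
    ∃ O ∈ 𝓝 t₀, ∀ E ⊆ O ∩ X, m φ 0 E = m χ s E with hP
  have hHs : ∀ s, Tendsto (fun t => H (t, s)) (𝓝[X] t₀) (𝓝 (H (t₀, s))) := by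
    intro s
    refine (hH (t₀, s) ⟨ht₀, trivial⟩).tendsto.comp (tendsto_nhdsWithin_iff.2 ⟨?_, ?_⟩)
    · exact ((Continuous.prodMk_left s).tendsto' t₀ (t₀, s) rfl).mono_left nhdsWithin_le_nhds
    · filter_upwards [self_mem_nhdsWithin] with t ht
      exact ⟨ht, trivial⟩
  -- `P s` does not depend on the flow-box around `H (t₀, s)`, because transverse measures
  -- correspond under changes of charts.
  have rebase : ∀ s, P s → ∀ χ, 𝓢.IsFlowBox χ → H (t₀, s) ∈ χ.source →
      ∃ O ∈ 𝓝 t₀, ∀ E ⊆ O ∩ X, m φ 0 E = m χ s E := by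
    rintro s ⟨χ', hχ', hs', O', hO', h'⟩ χ hχ hs
    obtain ⟨W, hW, hWE⟩ := transMeasure_eq G hχ' hχ (hμ _ hχ') (hμ _ hχ) hs' hs
    obtain ⟨O, hO, hOW⟩ := mem_nhdsWithin_iff_exists_mem_nhds_inter.1 (hHs s hW)
    refine ⟨O' ∩ O, inter_mem hO' hO, fun E hE => ?_⟩
    rw [h' E fun t ht => ⟨(hE ht).1.1, (hE ht).2⟩]
    have := hWE ((fun t => H (t, s)) '' E) (by
      rintro _ ⟨t, ht, rfl⟩
      exact hOW ⟨(hE ht).1.2, (hE ht).2⟩)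
    rw [Set.image_image, Set.image_image] at this
    exact this
  have loc : ∀ s, ∀ᶠ s' in 𝓝 s, (P s ↔ P s') := by
    intro s
    obtain ⟨χ, hχ, hs⟩ := 𝓢.exists_isFlowBox (H (t₀, s))
    have hpre := (hH (t₀, s) ⟨ht₀, trivial⟩) (χ.open_source.mem_nhds hs)
    obtain ⟨U, hU, hUX⟩ := mem_nhdsWithin_iff_exists_mem_nhds_inter.1 hpre
    obtain ⟨O, hO, J, hJ, hOJ⟩ := mem_nhds_prod_iff.1 hU
    obtain ⟨J', hJ', hJJ, hJc⟩ := unitInterval.exists_preconnected_nhds hJ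
    have hin : ∀ t ∈ O ∩ X, ∀ s' ∈ J', H (t, s') ∈ χ.source := fun t ht s' hs' =>
      hUX ⟨hOJ ⟨ht.1, hJJ hs'⟩, ht.2, trivial⟩
    have hsJ : s ∈ J' := mem_of_mem_nhds hJ'
    filter_upwards [hJ'] with s' hs'
    -- For times in `J'` all nearby paths stay in `χ`, and each stays in a single local leaf, so the
    -- set of transverse coordinates is the same at `s` and `s'`.
    have hm : ∀ E ⊆ O ∩ X, m χ s E = m χ s' E := by
      intro E hE
      simp only [hm]
      congr 1
      refine Set.image_congr fun t ht => ?_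
      exact hχ.snd_eq_of_path (hleaf t (hE ht).2) hJc (hin t (hE ht)) hsJ hs'
    have ht₀O : t₀ ∈ O ∩ X := ⟨mem_of_mem_nhds hO, ht₀⟩
    constructor
    · intro h
      obtain ⟨O', hO', h'⟩ := rebase s h χ hχ hs
      exact ⟨χ, hχ, hin t₀ ht₀O s' hs', O ∩ O', inter_mem hO hO', fun E hE =>
        (h' E fun t ht => ⟨(hE ht).1.2, (hE ht).2⟩).trans
          (hm E fun t ht => ⟨(hE ht).1.1, (hE ht).2⟩)⟩
    · intro h
      obtain ⟨O', hO', h'⟩ := rebase s' h χ hχ (hin t₀ ht₀O s' hs')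
      exact ⟨χ, hχ, hs, O ∩ O', inter_mem hO hO', fun E hE =>
        (h' E fun t ht => ⟨(hE ht).1.2, (hE ht).2⟩).trans
          (hm E fun t ht => ⟨(hE ht).1.1, (hE ht).2⟩).symm⟩
  have h01 : P 0 ↔ P 1 := isPreconnected_univ.induction₂ (fun s s' => P s ↔ P s')
    (fun s _ => mem_nhdsWithin_of_mem_nhds (loc s)) (fun _ _ _ _ _ _ h h' => h.trans h')
    (fun _ _ _ _ h => h.symm) (Set.mem_univ _) (Set.mem_univ _)
  exact rebase 1 (h01.1 ⟨φ, hφ, h₀, Set.univ, univ_mem, fun E _ => rfl⟩) ψ hψ h₁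

/-- The measure induced by `μ` on the local transversal of a flow-box. -/
noncomputable def transversalMeasure (φ : FlowBox k l S) (μ : Measure S) : Measure S :=
  (G.transMeasure φ μ).map fun y => φ.invFun (0, y)

lemma aemeasurable_inv_zero : AEMeasurable (fun y => φ.invFun (0, y)) (G.transMeasure φ μ) := by
  have h : (G.transMeasure φ μ).restrict φ.transv = G.transMeasure φ μ :=
    Measure.restrict_eq_self_of_ae_mem (ae_mem_of_compl (transMeasure_compl G))
  have hc : ContinuousOn (fun y => φ.invFun ((0 : Eu k), y)) φ.transv :=
    φ.continuousOn_invFun.comp (Continuous.prodMk_right (0 : Eu k)).continuousOn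
      fun y hy => zero_mk_mem_target hy
  exact h ▸ hc.aemeasurable φ.measurableSet_transv

lemma transversalMeasure_apply {E : Set S} (hE : MeasurableSet E) (hET : E ⊆ φ.transversal) :
    G.transversalMeasure φ μ E = G.transMeasure φ μ ((fun t => (φ.toFun t).2) '' E) := by
  unfold transversalMeasure
  rw [Measure.map_apply_of_aemeasurable (aemeasurable_inv_zero G) hE]
  refine measure_congr ?_
  filter_upwards [ae_mem_of_compl (transMeasure_compl (φ := φ) (μ := μ) G)] with y hy
  refine propext ⟨fun h => ⟨_, h, ?_⟩, ?_⟩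
  · simp only
    rw [toFun_inv (zero_mk_mem_target hy)]
  · rintro ⟨t, ht, rfl⟩
    have h := inv_zero_snd (hET ht)
    change φ.invFun (0, (φ.toFun t).2) ∈ E
    rwa [h]

lemma transversalMeasure_compl : G.transversalMeasure φ μ φ.transversalᶜ = 0 := by
  unfold transversalMeasure
  rw [Measure.map_apply_of_aemeasurable (aemeasurable_inv_zero G) measurableSet_transversal.compl]
  refine measure_mono_null (t := φ.transvᶜ) (fun y hy hyK => ?_) (transMeasure_compl G)
  exact hy (inv_zero_mem_transversal hyK)

lemma IsProductIn.disintegratesBy [IsFiniteMeasure μ] (h : G.IsProductIn φ μ)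
    (hφ : 𝓢.IsFlowBox φ) : G.DisintegratesBy φ μ (G.transversalMeasure φ μ) := by
  intro A hA hAU
  obtain ⟨F, hF, hFA⟩ := exists_measurable_plaqueVol G hφ hA
  have hT : ∀ᵐ t ∂(G.transversalMeasure φ μ), t ∈ φ.transversal := by
    rw [ae_iff]; exact transversalMeasure_compl G
  have hm : AEMeasurable φ.toFun (G.transversalMeasure φ μ) := by
    rw [← Measure.restrict_eq_self_of_ae_mem (s := φ.source)
      (hT.mono fun t ht => (mem_transversal.1 ht).1)]
    exact aemeasurable_toFun
  rw [h.disintegratesOn G hφ A hA hAU,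
    lintegral_congr_ae (hT.mono fun t ht => hFA _ (snd_mem (mem_transversal.1 ht).1)),
    lintegral_congr_ae ((ae_mem_of_compl (transMeasure_compl G)).mono fun y hy => hFA y hy)]
  unfold transversalMeasure at hm ⊢
  have hFm := hF.comp_aemeasurable hm.snd
  simp only [Function.comp_def] at hFm
  rw [lintegral_map' hFm (aemeasurable_inv_zero G)]
  refine lintegral_congr_ae ((ae_mem_of_compl (transMeasure_compl G)).mono fun y hy => ?_)
  simp only
  rw [toFun_inv (zero_mk_mem_target hy)]

/-- Near `t` the flattened measure gives a box finite mass; this mass is the positive volume of the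
disk factor times the transverse measure of the other factor, which is therefore finite. -/
lemma transversalMeasure_locally_finite [IsFiniteMeasure μ] (h : G.IsProductIn φ μ)
    (hφ : 𝓢.IsFlowBox φ) {t : S} (ht : t ∈ φ.transversal) :
    ∃ V ∈ 𝓝 t, G.transversalMeasure φ μ V < ⊤ := by
  obtain ⟨htU, ht0⟩ := mem_transversal.1 ht
  obtain ⟨W, hW, hWf⟩ := flatten_locally_finite G (μ := μ) hφ (toFun_mem htU)
  obtain ⟨r, hr, hrW⟩ := Metric.mem_nhds_iff.1 hW
  set B := Metric.ball (φ.toFun t).2 r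
  have hν : G.transMeasure φ μ B < ⊤ := by
    have h1 : G.flatten φ μ (Metric.ball (φ.toFun t).1 r ×ˢ B) < ⊤ := by
      refine (measure_mono ?_).trans_lt hWf
      rw [ball_prod_same]
      exact hrW
    rw [show G.flatten φ μ = _ from h, Measure.prod_prod] at h1
    refine ENNReal.lt_top_of_mul_ne_top_right h1.ne ?_
    rw [Measure.restrict_apply Metric.isOpen_ball.measurableSet]
    refine ((Metric.isOpen_ball.inter Metric.isOpen_ball).measure_pos volume ?_).ne'
    exact ⟨(φ.toFun t).1, Metric.mem_ball_self hr, fst_mem htU⟩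
  refine ⟨φ.box Set.univ B, box_mem_nhds htU univ_mem (Metric.ball_mem_nhds _ hr), ?_⟩
  unfold transversalMeasure
  rw [Measure.map_apply_of_aemeasurable (aemeasurable_inv_zero G)
    (isOpen_box isOpen_univ Metric.isOpen_ball).measurableSet]
  refine (measure_mono_ae ?_).trans_lt hν
  filter_upwards [ae_mem_of_compl (transMeasure_compl (φ := φ) (μ := μ) G)] with y hy h
  have h2 := h.2.2
  rwa [toFun_inv (zero_mk_mem_target hy)] at h2

/-- `transMeasure_holonomy` at the start and end times of the paths compares a small set with its
image under `h`, since `H (t, 0) = t` and `H (t, 1) = h t`; second countability makes the comparison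
global. -/
lemma transversalMeasure_invariant [IsFiniteMeasure μ]
    (hμ : ∀ φ, 𝓢.IsFlowBox φ → G.IsProductIn φ μ) (hφ : 𝓢.IsFlowBox φ) (hψ : 𝓢.IsFlowBox ψ)
    {T₁ T₂ : 𝓢.LocalTransversal} (hT₁ : T₁.1 = φ.transversal) (hT₂ : T₂.1 = ψ.transversal)
    {h : PartialEquiv S S} (hh : 𝓢.IsHolonomy T₁ T₂ h) :
    Measure.map h ((G.transversalMeasure φ μ).restrict h.source) =
      (G.transversalMeasure ψ μ).restrict h.target := by
  have := 𝓢.secondCountableTopology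
  obtain ⟨O₁, hO₁, hs⟩ := hh.source_open
  obtain ⟨O₂, hO₂, ht⟩ := hh.target_open
  obtain ⟨H, hH, hH'⟩ := hh.exists_paths
  rw [hT₁] at hs
  rw [hT₂] at ht
  have hsT : h.source ⊆ φ.transversal := hs ▸ Set.inter_subset_right
  have htT : h.target ⊆ ψ.transversal := ht ▸ Set.inter_subset_right
  have hsm : MeasurableSet h.source := hs ▸ hO₁.measurableSet.inter measurableSet_transversal
  have htm : MeasurableSet h.target := ht ▸ hO₂.measurableSet.inter measurableSet_transversal
  -- The measure on the target is pulled back, so that both measures live on the source of `h` and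
  -- can be compared locally there; it is pushed forward again at the end.
  set κ := ((G.transversalMeasure ψ μ).restrict h.target).map h.symm with hκ
  have hsymm : AEMeasurable h.symm ((G.transversalMeasure ψ μ).restrict h.target) :=
    hh.continuousOn_symm.aemeasurable htm
  have hκs : ∀ᵐ t ∂κ, t ∈ h.source := by
    refine (ae_map_iff (p := fun t => t ∈ h.source) hsymm hsm).2 ((ae_restrict_iff' htm).2 ?_)
    exact Eventually.of_forall fun t ht => h.map_target ht
  have key : ((G.transversalMeasure φ μ).restrict h.source).restrict h.source =
      κ.restrict h.source := by
    refine Measure.restrict_eq_of_locally fun t₀ ht₀ => ?_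
    obtain ⟨O, hO, hOE⟩ := transMeasure_holonomy G hμ hφ hψ (X := h.source) hH
      (fun t ht => (hH' t ht).2.2) ht₀
      (by rw [(hH' t₀ ht₀).1]; exact (mem_transversal.1 (hsT ht₀)).1)
      (by rw [(hH' t₀ ht₀).2.1]; exact (mem_transversal.1 (htT (h.map_source ht₀))).1)
    obtain ⟨O', hO'O, hO'o, htO'⟩ := mem_nhds_iff.1 hO
    refine ⟨O', hO'o.mem_nhds htO', ?_⟩
    ext E hE
    have hEO := hE.inter hO'o.measurableSet
    rw [Measure.restrict_apply hE, Measure.restrict_apply hE, Measure.restrict_apply hEO, hκ,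
      Measure.map_apply_of_aemeasurable hsymm hEO,
      Measure.restrict_apply' htm]
    set E' := E ∩ O' ∩ h.source with hE'
    have himg : h.symm ⁻¹' (E ∩ O') ∩ h.target = h '' E' := by
      rw [hE', Set.inter_comm, Set.inter_comm (E ∩ O'), h.image_source_inter_eq']
    have hmimg : MeasurableSet (h '' E') := by
      rw [← himg, Set.inter_comm]
      exact hh.continuousOn_symm.measurableSet_inter_preimage' htm hEO
    rw [himg, transversalMeasure_apply G (hEO.inter hsm) (Set.inter_subset_right.trans hsT),
      transversalMeasure_apply G hmimg (by rw [← himg]; exact Set.inter_subset_right.trans htT),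
      Set.image_image]
    have := hOE E' fun t ht => ⟨hO'O ht.1.2, ht.2⟩
    rw [Set.image_congr (g := fun t => (φ.toFun t).2) fun t ht => by rw [(hH' t ht.2).1],
      Set.image_congr (f := fun t => (ψ.toFun (H (t, 1))).2) (g := fun t => (ψ.toFun (h t)).2)
        fun t ht => by rw [(hH' t ht.2).2.1]] at this
    exact this
  rw [Measure.restrict_restrict_of_subset subset_rfl,
    Measure.restrict_eq_self_of_ae_mem hκs] at key
  have hmap : AEMeasurable h κ := by
    rw [← Measure.restrict_eq_self_of_ae_mem hκs]
    exact hh.continuousOn.aemeasurable hsm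
  rw [key, hκ, AEMeasurable.map_map_of_aemeasurable hmap hsymm]
  refine (Measure.map_congr (g := id) ?_).trans Measure.map_id
  exact (ae_restrict_iff' htm).2 (Eventually.of_forall fun t ht => h.right_inv ht)

/-- A finite measure which is a product in all flow-boxes comes from a transversal measure. -/
lemma exists_isTransversalMeasure [IsFiniteMeasure μ]
    (hμ : ∀ φ, 𝓢.IsFlowBox φ → G.IsProductIn φ μ) :
    ∃ m, 𝓢.IsTransversalMeasure m ∧
      ∀ φ (hφ : 𝓢.IsFlowBox φ), G.DisintegratesBy φ μ (m (𝓢.transversalOf φ hφ)) := by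
  -- A local transversal is only a set, and several flow-boxes may share it; one is chosen for each.
  choose Φ hΦ hT using fun T : 𝓢.LocalTransversal => T.2
  refine ⟨fun T => G.transversalMeasure (Φ T) μ, ⟨fun T => ?_, fun T t ht => ?_, ?_⟩, ?_⟩
  · rw [hT T]
    exact transversalMeasure_compl G
  · rw [hT T] at ht
    exact transversalMeasure_locally_finite G (hμ _ (hΦ T)) (hΦ T) ht
  · exact fun T₁ T₂ h hh =>
      transversalMeasure_invariant G hμ (hΦ T₁) (hΦ T₂) (hT T₁) (hT T₂) hh
  · intro φ hφ
    set T := 𝓢.transversalOf φ hφ with hTdef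
    -- The identity, with constant paths, is a holonomy map. Invariance under it shows that the
    -- measure does not depend on the chosen flow-box.
    have hh : 𝓢.IsHolonomy T T (PartialEquiv.ofSet T.1) := by
      refine ⟨⟨Set.univ, isOpen_univ, by simp⟩, ⟨Set.univ, isOpen_univ, by simp⟩, continuousOn_id,
        continuousOn_id, fun z => z.1, continuous_fst.continuousOn, fun t _ => ⟨rfl, rfl, ?_⟩⟩
      exact @continuous_const unitInterval S inferInstance 𝓢.leafTopology t
    have h := transversalMeasure_invariant G hμ (hΦ T) hφ (hT T) rfl hh
    have e : G.transversalMeasure (Φ T) μ = G.transversalMeasure φ μ := by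
      have h1 : ∀ᵐ t ∂(G.transversalMeasure (Φ T) μ), t ∈ T.1 := by
        rw [ae_iff, hT T]; exact transversalMeasure_compl G
      have h2 : ∀ᵐ t ∂(G.transversalMeasure φ μ), t ∈ T.1 := by
        rw [ae_iff]; exact transversalMeasure_compl G
      simp only [PartialEquiv.ofSet_source, PartialEquiv.ofSet_target, PartialEquiv.ofSet_coe,
        Measure.map_id, Measure.restrict_eq_self_of_ae_mem h1,
        Measure.restrict_eq_self_of_ae_mem h2] at h
      exact h
    beta_reduce
    rw [e]
    exact (hμ φ hφ).disintegratesBy G hφ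

end RiemannianMetric

end Solenoid

/-! ### Existence and uniqueness of limits; the theorem. -/

namespace Solenoid.RiemannianMetric

variable {k l : ℕ} {S : Type*} [TopologicalSpace S] {𝓢 : Solenoid k l S}
  {φ ψ : FlowBox k l S} (G : 𝓢.RiemannianMetric) [MeasurableSpace S] [BorelSpace S]

lemma isProbabilityMeasure_normalizedVol {L : Set S} {C : ℕ → Set S} (hL : 𝓢.IsLeaf L)
    (hC : 𝓢.IsExhaustion L C) : ∀ᶠ n in atTop, IsProbabilityMeasure (G.normalizedVol L (C n)) := by
  filter_upwards [leafVol_exhaustion_pos G hL hC] with n hn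
  refine ⟨?_⟩
  unfold normalizedVol
  rw [Measure.smul_apply, Measure.restrict_apply_univ, smul_eq_mul,
    ENNReal.inv_mul_cancel hn.ne' (leafVol_exhaustion_lt_top G hL hC n).ne]

/-- The transversal measure of a volume is not zero. -/
lemma transversalMeasure_ne_zero [CompactSpace S] {μ : Measure S} [IsProbabilityMeasure μ] {m : 𝓢.LocalTransversal → Measure S}
    (h : ∀ φ (hφ : 𝓢.IsFlowBox φ), G.DisintegratesBy φ μ (m (𝓢.transversalOf φ hφ))) : m ≠ 0 := by
  rintro rfl
  have := 𝓢.secondCountableTopology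
  have h0 : μ.restrict Set.univ = (0 : Measure S).restrict Set.univ := by
    refine Measure.restrict_eq_of_locally fun p _ => ?_
    obtain ⟨φ, hφ, hp⟩ := 𝓢.exists_isFlowBox p
    refine ⟨φ.source, φ.open_source.mem_nhds hp, ?_⟩
    rw [Measure.restrict_zero, Measure.restrict_eq_zero,
      h φ hφ _ measurableSet_source subset_rfl]
    simp
  rw [Measure.restrict_univ, Measure.restrict_univ] at h0
  exact IsProbabilityMeasure.ne_zero μ h0

/-- A uniquely ergodic solenoid has at most one volume. -/
lemma IsVolume.unique [CompactSpace S] {μ μ' : Measure S}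
    (hu : 𝓢.UniquelyErgodic) (h : G.IsVolume μ) (h' : G.IsVolume μ') :
    μ = μ' := by
  have := 𝓢.secondCountableTopology
  obtain ⟨m₀, -, -, -, huniq⟩ := hu
  obtain ⟨hp, m, hm, hd⟩ := h
  obtain ⟨hp', m', hm', hd'⟩ := h'
  obtain ⟨c, hc, hcm⟩ := huniq m hm (transversalMeasure_ne_zero G hd)
  obtain ⟨c', hc', hcm'⟩ := huniq m' hm' (transversalMeasure_ne_zero G hd')
  -- The transversal measures are `c • m₀` and `c' • m₀`, so cross-multiplication makes the
  -- disintegrations agree; total mass one then forces `c = c'`.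
  have key : (c' • μ).restrict Set.univ = (c • μ').restrict Set.univ := by
    refine Measure.restrict_eq_of_locally fun p _ => ?_
    obtain ⟨φ, hφ, hp⟩ := 𝓢.exists_isFlowBox p
    refine ⟨φ.source, φ.open_source.mem_nhds hp, ?_⟩
    ext A hA
    have hAU := hA.inter φ.measurableSet_source
    rw [Measure.restrict_apply hA, Measure.restrict_apply hA, Measure.smul_apply,
      Measure.smul_apply, hd φ hφ _ hAU Set.inter_subset_right,
      hd' φ hφ _ hAU Set.inter_subset_right, hcm, hcm', lintegral_smul_measure,
      lintegral_smul_measure, smul_comm]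
  rw [Measure.restrict_univ, Measure.restrict_univ] at key
  have hcc : c' = c := by
    have := congrArg (fun ν => ν Set.univ) key
    simpa only [Measure.smul_apply, measure_univ, ENNReal.smul_def, smul_eq_mul, mul_one,
      ENNReal.coe_inj] using this
  rw [hcc] at key
  have := congrArg (fun ν => c⁻¹ • ν) key
  simpa only [smul_smul, inv_mul_cancel₀ hc.ne', one_smul] using this

variable [CompactSpace S] [T2Space S] {μ : Measure S}

/-- Limits of normalized volumes, along any filter, are products in all flow-boxes. -/
lemma isProductIn_of_limit {L : Set S} {C : ℕ → Set S} (hL : 𝓢.IsLeaf L)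
    (hC : 𝓢.IsExhaustion L C) (hg : G.ControlledGrowthAlong L C) {𝓕 : Filter ℕ} [𝓕.NeBot]
    (h𝓕 : 𝓕 ≤ atTop) [IsFiniteMeasure μ]
    (hμ : ∀ f : C(S, ℝ), Tendsto (fun n => ∫ p, f p ∂(G.normalizedVol L (C n))) 𝓕
      (𝓝 (∫ p, f p ∂μ))) (hφ : 𝓢.IsFlowBox φ) : G.IsProductIn φ μ := by
  obtain ⟨F, -, hF, hcov, hgr⟩ := hg
  refine isProductIn_of_cover G (fun p => ?_) hφ
  have hp : p ∈ ⋃ φ ∈ F, φ.source := hcov ▸ Set.mem_univ p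
  obtain ⟨χ, hχ, hpχ⟩ := Set.mem_iUnion₂.1 hp
  exact ⟨χ, hF χ hχ, hpχ, isProductIn_of_locally G (hF χ hχ)
    (exists_const_of_limit G (hF χ hχ) hL hC (hgr χ hχ) h𝓕 hμ)⟩

lemma isDaval_of_isProductIn [IsFiniteMeasure μ]
    (h : ∀ φ, 𝓢.IsFlowBox φ → G.IsProductIn φ μ) : G.IsDaval μ := fun φ hφ =>
  ⟨G.transversalMeasure φ μ, transversalMeasure_compl G, (h φ hφ).disintegratesBy G hφ⟩

lemma IsSchwartzmanMeasure.isProductIn (h : G.IsSchwartzmanMeasure μ) :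
    ∀ φ, 𝓢.IsFlowBox φ → G.IsProductIn φ μ := by
  obtain ⟨hp, L, C, hL, hC, hg, hlim⟩ := h
  exact fun φ hφ => isProductIn_of_limit G hL hC hg le_rfl hlim hφ

/-- The normalized volumes converge along every ultrafilter. -/
lemma exists_limit {L : Set S} {C : ℕ → Set S} (hL : 𝓢.IsLeaf L) (hC : 𝓢.IsExhaustion L C)
    (𝓕 : Ultrafilter ℕ) (h𝓕 : (𝓕 : Filter ℕ) ≤ atTop) :
    ∃ μ : Measure S, IsProbabilityMeasure μ ∧ ∀ f : C(S, ℝ),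
      Tendsto (fun n => ∫ p, f p ∂(G.normalizedVol L (C n))) 𝓕 (𝓝 (∫ p, f p ∂μ)) := by
  have := 𝓢.secondCountableTopology
  obtain ⟨p₀, -⟩ := hL.connected.1
  -- The normalized volume is known to be a probability measure only for large `n`; a Dirac mass
  -- fills the other places.
  have hex : ∀ n, ∃ Q : ProbabilityMeasure S,
      IsProbabilityMeasure (G.normalizedVol L (C n)) → (Q : Measure S) = G.normalizedVol L (C n) := by
    intro n
    by_cases h : IsProbabilityMeasure (G.normalizedVol L (C n))
    · exact ⟨⟨_, h⟩, fun _ => rfl⟩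
    · exact ⟨⟨Measure.dirac p₀, inferInstance⟩, fun h' => absurd h' h⟩
  choose P hP using hex
  obtain ⟨μ, -, hμ⟩ := (isCompact_univ (X := ProbabilityMeasure S)).ultrafilter_le_nhds
    (𝓕.map P) (by simp)
  refine ⟨μ, inferInstance, fun f => ?_⟩
  have ht : Tendsto P 𝓕 (𝓝 μ) := hμ
  have := ProbabilityMeasure.tendsto_iff_forall_integral_tendsto.1 ht
    (BoundedContinuousFunction.mkOfCompact f)
  refine this.congr' ?_
  filter_upwards [h𝓕 (isProbabilityMeasure_normalizedVol G hL hC)] with n hn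
  rw [hP n hn]
  rfl

/-- A probability measure which is a product in all flow-boxes is a volume. -/
lemma isVolume_of_isProductIn [IsProbabilityMeasure μ]
    (h : ∀ φ, 𝓢.IsFlowBox φ → G.IsProductIn φ μ) : G.IsVolume μ :=
  ⟨inferInstance, exists_isTransversalMeasure G h⟩

/-- In a uniquely ergodic solenoid, all normalized volumes converge to the volume. -/
lemma isSchwartzmanLimit_of_isVolume (hu : 𝓢.UniquelyErgodic) (hμ : G.IsVolume μ) {L : Set S}
    {C : ℕ → Set S} (hL : 𝓢.IsLeaf L) (hC : 𝓢.IsExhaustion L C)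
    (hg : G.ControlledGrowthAlong L C) : G.IsSchwartzmanLimit L C μ := by
  intro f
  rw [tendsto_iff_ultrafilter]
  -- It suffices to identify the limit along each ultrafilter: it is a volume, hence equal to `μ`.
  intro 𝓕 h𝓕
  obtain ⟨μ', hp', hlim⟩ := exists_limit G hL hC 𝓕 h𝓕
  have := isVolume_of_isProductIn G fun φ hφ => isProductIn_of_limit G hL hC hg h𝓕 hlim hφ
  rw [IsVolume.unique G hu hμ this]
  exact hlim f

end Solenoid.RiemannianMetric

open Solenoid.RiemannianMetric

theorem mainTheorem9 {k l : ℕ} {S : Type*} [TopologicalSpace S] [CompactSpace S] [T2Space S]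
    [MeasurableSpace S] [BorelSpace S] (𝓢 : Solenoid k l S) (G : 𝓢.RiemannianMetric)
    (hG : G.HasControlledGrowth) :
    (∀ μ : Measure S, G.IsSchwartzmanMeasure μ → IsProbabilityMeasure μ ∧ G.IsDaval μ) ∧
    (∃ μ : Measure S, IsProbabilityMeasure μ ∧ G.IsDaval μ) ∧
    (∃ m, 𝓢.IsTransversalMeasure m ∧ m ≠ 0) ∧
    (𝓢.UniquelyErgodic →
      ∃ μ : Measure S,
        (∀ μ' : Measure S, G.IsVolume μ' ↔ μ' = μ) ∧
        (∀ μ' : Measure S, G.IsSchwartzmanMeasure μ' ↔ μ' = μ) ∧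
        ∀ L C, 𝓢.IsLeaf L → 𝓢.IsExhaustion L C → G.ControlledGrowthAlong L C →
          G.IsSchwartzmanLimit L C μ) := by
  obtain ⟨L, C, hL, hC, hg⟩ := hG
  -- Without unique ergodicity the `μ_n` may fail to converge; a limit along one ultrafilter is
  -- enough to get a volume.
  obtain ⟨μ, hp, hlim⟩ := exists_limit G hL hC (Ultrafilter.of atTop) (Ultrafilter.of_le atTop)
  have hprod : ∀ φ, 𝓢.IsFlowBox φ → G.IsProductIn φ μ := fun φ hφ =>
    isProductIn_of_limit G hL hC hg (Ultrafilter.of_le atTop) hlim hφ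
  have hvol : G.IsVolume μ := isVolume_of_isProductIn G hprod
  refine ⟨fun μ' h => ⟨h.1, ?_⟩, ⟨μ, hp, isDaval_of_isProductIn G hprod⟩, ?_, fun hu => ?_⟩
  · have := h.1
    exact isDaval_of_isProductIn G (h.isProductIn G)
  · obtain ⟨m, hm, hd⟩ := hvol.2
    exact ⟨m, hm, transversalMeasure_ne_zero G hd⟩
  · refine ⟨μ, fun μ' => ⟨fun h => h.unique G hu hvol, fun h => h ▸ hvol⟩, fun μ' => ⟨fun h => ?_,
      ?_⟩, fun L C hL hC hg => isSchwartzmanLimit_of_isVolume G hu hvol hL hC hg⟩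
    · have := h.1
      exact (isVolume_of_isProductIn G (h.isProductIn G)).unique G hu hvol
    · rintro rfl
      exact ⟨hp, L, C, hL, hC, hg, isSchwartzmanLimit_of_isVolume G hu hvol hL hC hg⟩
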